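/- Let $I\subseteq\mathbb R$ be a nonempty open interval (for instance $I=\mathbb R$), let $R:I\to(0,\infty)$ be smooth, and equip $M=I\times S^3$ with the metric which in each of the two stereographic charts $(x^0,x^1,x^2,x^3)\in I\times\mathbb R^3$ (projection of $S^3$ from the North Pole, resp. from the South Pole; on the overlap the charts are related by $x^0\mapsto x^0$, $x^k\mapsto x^k/|x|^2$, $k=1,2,3$) has the form $$ds^2=R^2\,(dx^0)^2-\frac{4R^2\left((dx^1)^2+(dx^2)^2+(dx^3)^2\right)}{(|x|^2+1)^2},\qquad R=R(x^0),\quad |x|^2=(x^1)^2+(x^2)^2+(x^3)^2 .$$ A Killing field is a smooth vector field $X$ on $M$ with $L_Xg=0$. Write $X_i=\sum_j g_{ij}X^j$ and $Y_{ij}=\nabla_iX_j$ ($\nabla$ the Levi-Civita connection). Then: 1. Every Killing field $X$ satisfies, everywhere on $M$ and in both charts, the compatibility conditions $$\left(4(R')^3-5R''R'R+R'''R^2\right)X_0=0,\qquad R'\left(2(R')^2-R''R+R^2\right)X_0=0,$$ $$\left(2(R')^2-R''R+R^2\right)\left(R'X_k-R\,Y_{0k}\right)=0,\qquad k=1,2,3.$$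 2. If there is a Killing field with $X_0\neq0$ at some point of $M$, then either $R'=0$ identically on $I$, or $2(R')^2-R''R+R^2=0$ identically on $I$. 3. For every $R$, the six rotations of $S^3$ are Killing fields. In North Pole coordinates these are the three meridional rotations $$\frac{1-|x|^2}{2}\,\frac{\partial}{\partial x^k}+x^k\sum_{j=1}^3x^j\frac{\partial}{\partial x^j}\quad(k=1,2,3)$$ and the three equatorial rotations $x^2\partial_1-x^1\partial_2$, $x^3\partial_2-x^2\partial_3$, $x^1\partial_3-x^3\partial_1$, where $\partial_k=\partial/\partial x^k$. 4. Suppose that neither $R'$ nor $2(R')^2-R''R+R^2$ vanishes identically on $I$ (the general case). Then every Killing field $X$ has $X_0=0$ everywhere, is not time-like at any point ($g(X,X)>0$ nowhere), and is space-like ($g(X,X)<0$) wherever it does not vanish. In particular there is no time-like Killing field. A vector field on $M$ is a Killing field if and only if it is a linear combination, with constant and uniquely determined coefficients, of the six rotations. -/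

import Mathlib

open scoped ContDiff

namespace ClosedUniverse

noncomputable section

/-- Coordinates `(x⁰, x¹, x², x³)` in one stereographic chart of `I × S³`: `x⁰` is the (conformal)
time and `(x¹, x², x³)` is the stereographic projection of the point of `S³`. -/
abbrev Coord : Type := Fin 4 → ℝ

/-- The partial derivative `∂f/∂xⁱ` at `x`. -/
def pd (i : Fin 4) (f : Coord → ℝ) (x : Coord) : ℝ := fderiv ℝ f x (Pi.single i 1)

/-- `|x|² = (x¹)² + (x²)² + (x³)²`. -/
def spaceSq (x : Coord) : ℝ := x 1 ^ 2 + x 2 ^ 2 + x 3 ^ 2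

/-- The range of either stereographic chart: `I × ℝ³`. -/
def dom (I : Set ℝ) : Set Coord := {x | x 0 ∈ I}

/-- The transition function between the North Pole and the South Pole stereographic
coordinates (in both directions), `(x⁰, 𝐱) ↦ (x⁰, 𝐱 / |𝐱|²)`, meaningful for `𝐱 ≠ 0`. -/
def transition (x : Coord) : Coord :=
  ![x 0, x 1 / spaceSq x, x 2 / spaceSq x, x 3 / spaceSq x]

/-- A smooth vector field on `I × S³`, given by its contravariant components in the two
stereographic charts, which cover `I × S³`: smooth on each chart, and related on the overlap
by the Jacobian matrix of the transition function. Values outside `dom I` have no meaning. -/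
structure VField (I : Set ℝ) where
  north : Coord → Coord
  south : Coord → Coord
  smooth_north : ContDiffOn ℝ ∞ north (dom I)
  smooth_south : ContDiffOn ℝ ∞ south (dom I)
  compatible : ∀ x ∈ dom I, spaceSq x ≠ 0 →
    south (transition x) = fderiv ℝ transition x (north x)

/-- The metric `R² (dx⁰)² - 4 R² ((dx¹)² + (dx²)² + (dx³)²) / (|x|² + 1)²`, with `R = R(x⁰)`.
It has this same form in both stereographic charts. -/
def metric (R : ℝ → ℝ) (x : Coord) : Matrix (Fin 4) (Fin 4) ℝ :=
  Matrix.diagonal fun i =>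
    if i = 0 then R (x 0) ^ 2 else -(4 * R (x 0) ^ 2 / (spaceSq x + 1) ^ 2)

/-- The components `(L_V g)_{ij}` of the Lie derivative of the metric in one chart. -/
def lieMetric (R : ℝ → ℝ) (V : Coord → Coord) (x : Coord) (i j : Fin 4) : ℝ :=
  ∑ s, V x s * pd s (fun y => metric R y i j) x
    + ∑ s, metric R x s j * pd i (fun y => V y s) x
    + ∑ s, metric R x i s * pd j (fun y => V y s) x

/-- `X` is a Killing vector field: `L_X g = 0` on all of `I × S³`. -/
def IsKilling {I : Set ℝ} (R : ℝ → ℝ) (X : VField I) : Prop :=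
  ∀ x ∈ dom I, ∀ i j, lieMetric R X.north x i j = 0 ∧ lieMetric R X.south x i j = 0

/-- The covariant components `V_i = ∑ⱼ g_{ij} Vʲ`. -/
def lower (R : ℝ → ℝ) (V : Coord → Coord) (i : Fin 4) (x : Coord) : ℝ :=
  ∑ j, metric R x i j * V x j

/-- The Christoffel symbols `Γᵏ_{ij}` of the Levi-Civita connection. -/
def christoffel (R : ℝ → ℝ) (k i j : Fin 4) (x : Coord) : ℝ :=
  ∑ s, (metric R x)⁻¹ k s / 2 *
    (pd j (fun y => metric R y i s) x + pd i (fun y => metric R y s j) x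
      - pd s (fun y => metric R y i j) x)

/-- The covariant derivative `Y_{ij} = ∇_i V_j` of the covector field associated with `V`. -/
def covDeriv (R : ℝ → ℝ) (V : Coord → Coord) (i j : Fin 4) (x : Coord) : ℝ :=
  pd i (lower R V j) x - ∑ k, christoffel R k i j x * lower R V k x

/-- The value `g(V, V)` at `x`. -/
def normSq (R : ℝ → ℝ) (V : Coord → Coord) (x : Coord) : ℝ :=
  ∑ i, ∑ j, metric R x i j * V x i * V x j

/-- `V` is time-like at `x` (the signature is `+ - - -`). -/
def TimelikeAt (R : ℝ → ℝ) (V : Coord → Coord) (x : Coord) : Prop := 0 < normSq R V x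

/-- `V` is space-like at `x`. -/
def SpacelikeAt (R : ℝ → ℝ) (V : Coord → Coord) (x : Coord) : Prop := normSq R V x < 0

/-- The expression `2 (R')² - R'' R + R²`. -/
def excess (R : ℝ → ℝ) (t : ℝ) : ℝ :=
  2 * deriv R t ^ 2 - deriv (deriv R) t * R t + R t ^ 2

/-- The compatibility conditions at `x` for a vector field with components `V` in a chart:
two for `V_0` and three relating `V_k` to `Y_{0k} = ∇_0 V_k`, `k = 1, 2, 3`. -/
def CompatibilityAt (R : ℝ → ℝ) (V : Coord → Coord) (x : Coord) : Prop :=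
  (4 * deriv R (x 0) ^ 3 - 5 * deriv (deriv R) (x 0) * deriv R (x 0) * R (x 0)
      + deriv (deriv (deriv R)) (x 0) * R (x 0) ^ 2) * lower R V 0 x = 0 ∧
  deriv R (x 0) * excess R (x 0) * lower R V 0 x = 0 ∧
  ∀ k : Fin 4, k ≠ 0 →
    excess R (x 0) * (deriv R (x 0) * lower R V k x - R (x 0) * covDeriv R V 0 k x) = 0

/-- North Pole components of the six rotations of `S³`: for `k = 0, 1, 2` the meridional
rotations in the planes `z¹Oz⁴`, `z²Oz⁴`, `z³Oz⁴`, for `k = 3, 4, 5` the equatorial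
rotations in the planes `z¹Oz²`, `z²Oz³`, `z³Oz¹`. -/
def rotationNorth : Fin 6 → Coord → Coord :=
  ![fun x => ![0, (2 * x 1 ^ 2 - spaceSq x + 1) / 2, x 1 * x 2, x 1 * x 3],
    fun x => ![0, x 2 * x 1, (2 * x 2 ^ 2 - spaceSq x + 1) / 2, x 2 * x 3],
    fun x => ![0, x 3 * x 1, x 3 * x 2, (2 * x 3 ^ 2 - spaceSq x + 1) / 2],
    fun x => ![0, x 2, -x 1, 0],
    fun x => ![0, 0, x 3, -x 2],
    fun x => ![0, -x 3, 0, x 1]]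

/-- The same six fields in South Pole coordinates: the two charts differ by the
reflection `z⁴ ↦ -z⁴`, which reverses the meridional rotations and keeps the equatorial ones. -/
def rotationSouth (k : Fin 6) (y : Coord) : Coord :=
  if k.val < 3 then -rotationNorth k y else rotationNorth k y

theorem contDiff_rotationNorth (k : Fin 6) : ContDiff ℝ ∞ (rotationNorth k) := by
  rw [contDiff_pi]
  intro i
  fin_cases k <;> fin_cases i <;> simp [rotationNorth, spaceSq] <;> fun_prop

theorem contDiff_rotationSouth (k : Fin 6) : ContDiff ℝ ∞ (rotationSouth k) := by
  by_cases h : k.val < 3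
  · have : rotationSouth k = fun y => -rotationNorth k y := by
      funext y; simp [rotationSouth, h]
    rw [this]; exact (contDiff_rotationNorth k).neg
  · have : rotationSouth k = rotationNorth k := by
      funext y; simp [rotationSouth, h]
    rw [this]; exact contDiff_rotationNorth k

theorem hasFDerivAt_spaceSq (x : Coord) :
    HasFDerivAt spaceSq ((2 * x 1) • ContinuousLinearMap.proj (R := ℝ) (φ := fun _ : Fin 4 => ℝ) 1
      + (2 * x 2) • ContinuousLinearMap.proj (R := ℝ) (φ := fun _ : Fin 4 => ℝ) 2
      + (2 * x 3) • ContinuousLinearMap.proj (R := ℝ) (φ := fun _ : Fin 4 => ℝ) 3) x := by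
  have h (i : Fin 4) := (hasFDerivAt_apply (𝕜 := ℝ) i x).pow 2
  have := ((h 1).add (h 2)).add (h 3)
  have e : ((2 : ℕ) • x 1 ^ (2 - 1)) = 2 * x 1 ∧ ((2 : ℕ) • x 2 ^ (2 - 1)) = 2 * x 2 ∧
      ((2 : ℕ) • x 3 ^ (2 - 1)) = 2 * x 3 := by simp
  rw [e.1, e.2.1, e.2.2] at this
  exact this

theorem fderiv_transition (x v : Coord) (hx : spaceSq x ≠ 0) :
    fderiv ℝ transition x v =
      let p := 2 * (x 1 * v 1 + x 2 * v 2 + x 3 * v 3)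
      ![v 0, (v 1 * spaceSq x - x 1 * p) / spaceSq x ^ 2,
        (v 2 * spaceSq x - x 2 * p) / spaceSq x ^ 2,
        (v 3 * spaceSq x - x 3 * p) / spaceSq x ^ 2] := by
  have hq (i : Fin 4) := (hasFDerivAt_apply (𝕜 := ℝ) i x).fun_mul
    ((hasDerivAt_inv hx).comp_hasFDerivAt x (hasFDerivAt_spaceSq x))
  have hd : DifferentiableAt ℝ transition x := by
    rw [differentiableAt_pi]
    intro i
    fin_cases i
    · exact (hasFDerivAt_apply (𝕜 := ℝ) (0 : Fin 4) x).differentiableAt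
    · exact (hq 1).differentiableAt
    · exact (hq 2).differentiableAt
    · exact (hq 3).differentiableAt
  have hc (i : Fin 4) := hasFDerivAt_pi'.1 hd.hasFDerivAt i
  have e0 := congrArg (fun L => L v) ((hc 0).unique (hasFDerivAt_apply (𝕜 := ℝ) (0 : Fin 4) x))
  have e1 := congrArg (fun L => L v) ((hc 1).unique (hq 1))
  have e2 := congrArg (fun L => L v) ((hc 2).unique (hq 2))
  have e3 := congrArg (fun L => L v) ((hc 3).unique (hq 3))
  simp at e0 e1 e2 e3
  funext i
  fin_cases i
  · simpa using e0
  · simp [e1]; field_simp; ring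
  · simp [e2]; field_simp; ring
  · simp [e3]; field_simp; ring

/-- The six rotations of `S³` as vector fields on `I × S³`. -/
def rotation (I : Set ℝ) (k : Fin 6) : VField I where
  north := rotationNorth k
  south := rotationSouth k
  smooth_north := (contDiff_rotationNorth k).contDiffOn
  smooth_south := (contDiff_rotationSouth k).contDiffOn
  compatible := by
    intro x _ hx
    rw [fderiv_transition x _ hx]
    have hs : spaceSq (transition x) = 1 / spaceSq x := by
      have : spaceSq (transition x)
          = (x 1 ^ 2 + x 2 ^ 2 + x 3 ^ 2) / spaceSq x ^ 2 := by
        simp only [spaceSq, transition, Matrix.cons_val]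
        simp only [div_pow, add_div]
      rw [this, show x 1 ^ 2 + x 2 ^ 2 + x 3 ^ 2 = spaceSq x from rfl]
      field_simp
    have h1 : transition x 1 = x 1 / spaceSq x := rfl
    have h2 : transition x 2 = x 2 / spaceSq x := rfl
    have h3 : transition x 3 = x 3 / spaceSq x := rfl
    have hn : spaceSq x = x 1 ^ 2 + x 2 ^ 2 + x 3 ^ 2 := rfl
    funext i
    fin_cases k <;> fin_cases i <;>
      simp [rotationSouth, rotationNorth, hs, h1, h2, h3] <;>
      field_simp <;> (try rw [hn]) <;> ring

/-- `X = ∑ₖ cₖ Kₖ` on `I × S³`, where `K₀, …, K₅` are the six rotations. -/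
def IsRotationCombination {I : Set ℝ} (X : VField I) (c : Fin 6 → ℝ) : Prop :=
  ∀ x ∈ dom I, X.north x = ∑ k, c k • (rotation I k).north x ∧
    X.south x = ∑ k, c k • (rotation I k).south x

end

end ClosedUniverse

/-!
In a stereographic chart the metric is `R² (dt² - σ)` with `σ` the round metric `4 |dx|² / S²`,
`S = 1 + |x|²`. For a Killing field put `f = R V⁰`. Killing's equations say that `f` does not depend
on time, that `∂ₜVᵏ = S² ∂ₖf / (4 R)`, and that the spatial part of `V` is a conformal field of flat
space whose factor `T = ∂ₖVᵏ` satisfies `S (T + ρ f) = 2 x · V`, where `ρ = R' / R²`.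

Differentiating the spatial equations in time shows that `f` solves the Hessian equation
`Hess f = -μ f σ` on the round sphere, where
`μ = R ρ' = 1 - (2 R'² - R'' R + R²) / R²`. Three consequences follow.
* The Hessian does not depend on time, so `μ' f = 0` (`Frame.Killing.d_zero_mu_mul_pot`).
* The third derivatives of `f` commute, so `(μ - 1) df = 0`
  (`Frame.Killing.mu_sub_one_mul_d_pot`).
* The conformal factor `T` is affine in the flat coordinates (`Frame.Killing.d_d_conf`), which
  together with the Hessian equation gives `ρ (1 - μ) f = 0`
  (`Frame.Killing.rho_mul_one_sub_mu_mul_pot`).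

These are the compatibility conditions (`compatibilityAt`). If `f` is nonzero somewhere, it is
nonzero along a whole time line, where `μ` is then constant and `R' (1 - μ) = 0`; this is the
alternative `deriv_eq_zero_or_excess_eq_zero`. If neither case occurs then `V⁰ = 0`, so `V` does not
depend on time and is a Killing field of the sphere. After subtraction of a combination of rotations
with the same value and curl at the South Pole, which is the origin of the North Pole chart, the
affine function `T` and its gradient vanish at the origin, so `T = 0`, hence all second and then all
first derivatives of `V` vanish (`components_eq_zero`). The result passes to the South Pole chart by
the transition function, and to its origin by continuity (`isRotationCombination_of_north`).

The identities above are purely algebraic: they are proved in a commutative algebra with commuting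
derivations (`Frame`), which is then taken to be the algebra of smooth functions on a chart
(`chartFrame`).
-/

namespace ClosedUniverse

/-! ### Smooth functions as a differential ring -/

theorem pd_congr {U : Set Coord} (hU : IsOpen U) {f g : Coord → ℝ} (h : Set.EqOn f g U)
    (i : Fin 4) {x : Coord} (hx : x ∈ U) : pd i f x = pd i g x := by
  unfold pd
  rw [Filter.EventuallyEq.fderiv_eq (h.eventuallyEq_of_mem (hU.mem_nhds hx))]

theorem contDiffOn_pd {U : Set Coord} (hU : IsOpen U) {f : Coord → ℝ}
    (hf : ContDiffOn ℝ ∞ f U) (i : Fin 4) : ContDiffOn ℝ ∞ (pd i f) U :=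
  (hf.fderiv_of_isOpen hU (by simp)).clm_apply contDiffOn_const

theorem pd_comm {U : Set Coord} (hU : IsOpen U) {f : Coord → ℝ} (hf : ContDiffOn ℝ ∞ f U)
    (i j : Fin 4) {x : Coord} (hx : x ∈ U) : pd i (pd j f) x = pd j (pd i f) x := by
  have hd : DifferentiableAt ℝ (fderiv ℝ f) x :=
    ((hf.fderiv_of_isOpen (m := ∞) hU (by simp)).differentiableOn (by simp)).differentiableAt
      (hU.mem_nhds hx)
  have key (a b : Fin 4) :
      pd a (pd b f) x = fderiv ℝ (fderiv ℝ f) x (Pi.single a 1) (Pi.single b 1) := by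
    unfold pd
    rw [fderiv_clm_apply hd (differentiableAt_const _)]
    simp
  rw [key, key]
  exact (hf.contDiffAt (hU.mem_nhds hx)).isSymmSndFDerivAt
    (by simpa using WithTop.coe_le_coe.2 (le_top (a := (2 : ℕ∞)))) _ _

/-- The extension by zero of a function on `U`. -/
noncomputable def zeroExt {U : Set Coord} (f : U → ℝ) : Coord → ℝ :=
  Function.extend Subtype.val f 0

@[simp]
theorem zeroExt_apply {U : Set Coord} (f : U → ℝ) (x : U) : zeroExt f x = f x :=
  Subtype.val_injective.extend_apply f 0 x

theorem eqOn_zeroExt {U : Set Coord} {f : U → ℝ} {F : Coord → ℝ} (h : ∀ x : U, f x = F x) :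
    Set.EqOn (zeroExt f) F U := fun x hx => (zeroExt_apply f ⟨x, hx⟩).trans (h ⟨x, hx⟩)

/-- The algebra of smooth functions on `U`, as functions on the subtype. Forgetting the values
outside `U` makes identities between functions on `U` equalities, which can be differentiated. -/
noncomputable def smoothAlg (U : Set Coord) : Subalgebra ℝ (U → ℝ) where
  carrier := {f | ContDiffOn ℝ ∞ (zeroExt f) U}
  mul_mem' {f g} hf hg :=
    (ContDiffOn.mul hf hg).congr (eqOn_zeroExt fun x => by simp)
  add_mem' {f g} hf hg :=
    (ContDiffOn.add hf hg).congr (eqOn_zeroExt fun x => by simp)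
  algebraMap_mem' c :=
    (contDiffOn_const (c := c)).congr (eqOn_zeroExt fun x => by simp)

/-- The restriction to `U` of a function that is smooth on `U`. -/
noncomputable def restrict {U : Set Coord} (F : Coord → ℝ) (hF : ContDiffOn ℝ ∞ F U) :
    smoothAlg U :=
  ⟨fun x => F x, hF.congr (eqOn_zeroExt fun _ => rfl)⟩

/-- Evaluation of a smooth function at a point of `U`. -/
noncomputable def evalAt {U : Set Coord} (x : U) : smoothAlg U →+* ℝ :=
  (Pi.evalRingHom _ x).comp (smoothAlg U).val.toRingHom

@[simp]
theorem evalAt_restrict {U : Set Coord} (F : Coord → ℝ) (hF : ContDiffOn ℝ ∞ F U) (x : U) :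
    evalAt x (restrict F hF) = F x := rfl

@[simp]
theorem evalAt_algebraMap {U : Set Coord} (c : ℝ) (x : U) :
    evalAt x (algebraMap ℝ (smoothAlg U) c) = c := rfl

theorem smoothAlg_ext {U : Set Coord} {a b : smoothAlg U} (h : ∀ x, evalAt x a = evalAt x b) :
    a = b := Subtype.ext (funext h)

theorem differentiableAt_zeroExt {U : Set Coord} (hU : IsOpen U) (a : smoothAlg U) (x : U) :
    DifferentiableAt ℝ (zeroExt a.1) x :=
  (ContDiffOn.differentiableOn a.2 (by simp)).differentiableAt (hU.mem_nhds x.2)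

/-- The partial derivative `∂ᵢ` as a derivation of the algebra of smooth functions on `U`. -/
noncomputable def partialDer {U : Set Coord} (hU : IsOpen U) (i : Fin 4) :
    Derivation ℝ (smoothAlg U) (smoothAlg U) :=
  Derivation.mk'
    { toFun := fun a => restrict (pd i (zeroExt a.1)) (contDiffOn_pd hU a.2 i)
      map_add' := fun a b => smoothAlg_ext fun x => by
        have h := pd_congr hU (eqOn_zeroExt (f := (a + b).1)
          (F := fun y => zeroExt a.1 y + zeroExt b.1 y) fun y => by simp) i x.2
        rw [map_add, evalAt_restrict, evalAt_restrict, evalAt_restrict, h]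
        unfold pd
        rw [fderiv_fun_add (differentiableAt_zeroExt hU a x) (differentiableAt_zeroExt hU b x)]
        rfl
      map_smul' := fun c a => smoothAlg_ext fun x => by
        have h := pd_congr hU (eqOn_zeroExt (f := (c • a).1)
          (F := fun y => c • zeroExt a.1 y) fun y => by simp) i x.2
        rw [evalAt_restrict, h, RingHom.id_apply, Algebra.smul_def, map_mul, evalAt_restrict,
          evalAt_algebraMap]
        unfold pd
        rw [fderiv_fun_const_smul (differentiableAt_zeroExt hU a x)]
        rfl }
    fun a b => smoothAlg_ext fun x => by
      have h := pd_congr hU (eqOn_zeroExt (f := (a * b).1)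
        (F := fun y => zeroExt a.1 y * zeroExt b.1 y) fun y => by simp) i x.2
      simp only [LinearMap.coe_mk, AddHom.coe_mk, smul_eq_mul, map_add, map_mul, evalAt_restrict]
      rw [h]
      unfold pd
      rw [fderiv_fun_mul (differentiableAt_zeroExt hU a x) (differentiableAt_zeroExt hU b x)]
      simp
      rfl

theorem evalAt_partialDer {U : Set Coord} (hU : IsOpen U) (i : Fin 4) (a : smoothAlg U) (x : U) :
    evalAt x (partialDer hU i a) = pd i (zeroExt a.1) x := rfl

theorem evalAt_partialDer_of_eq {U : Set Coord} (hU : IsOpen U) (i : Fin 4) {a : smoothAlg U}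
    {F : Coord → ℝ} (h : ∀ x : U, evalAt x a = F x) (x : U) :
    evalAt x (partialDer hU i a) = pd i F x :=
  pd_congr hU (eqOn_zeroExt (f := a.1) h) i x.2

theorem partialDer_comm {U : Set Coord} (hU : IsOpen U) (i j : Fin 4) (a : smoothAlg U) :
    partialDer hU i (partialDer hU j a) = partialDer hU j (partialDer hU i a) :=
  smoothAlg_ext fun x => by
    have h (i j : Fin 4) : evalAt x (partialDer hU i (partialDer hU j a))
        = pd i (pd j (zeroExt a.1)) x :=
      evalAt_partialDer_of_eq hU i (evalAt_partialDer hU j a) x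
    rw [h, h, pd_comm hU a.2 i j x.2]

theorem fderiv_eq_zero_of_pd_eq_zero {f : Coord → ℝ} {x : Coord} (h : ∀ i, pd i f x = 0) :
    fderiv ℝ f x = 0 := by
  refine ContinuousLinearMap.coe_injective (LinearMap.pi_ext' fun i => LinearMap.ext_ring ?_)
  simpa [pd] using h i

theorem evalAt_eq_of_partialDer_eq_zero {U : Set Coord} (hU : IsOpen U) (hc : IsPreconnected U)
    {a : smoothAlg U} (h : ∀ i, partialDer hU i a = 0) (x y : U) : evalAt x a = evalAt y a := by
  have := hU.is_const_of_fderiv_eq_zero (𝕜 := ℝ) hc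
    (ContDiffOn.differentiableOn a.2 (by simp))
    (fun z hz => fderiv_eq_zero_of_pd_eq_zero fun i => by
      have := congrArg (evalAt ⟨z, hz⟩) (h i)
      rwa [evalAt_partialDer, map_zero] at this) x.2 y.2
  rwa [zeroExt_apply, zeroExt_apply] at this

/-! ### Killing fields over a commutative ring with commuting derivations -/

/-- The differential-algebraic data of the metric: a commutative algebra with commuting derivations
`∂ᵢ`, the space coordinates `x`, the scale factor `r` with its inverse `r'`, and the inverse `q` of
`1 + |x|²`. The index `k : Fin 3` of a space direction stands for `k.succ : Fin 4`. -/
structure Frame (A : Type*) [CommRing A] [Algebra ℝ A] where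
  d : Fin 4 → Derivation ℝ A A
  comm : ∀ i j a, d i (d j a) = d j (d i a)
  x : Fin 3 → A
  d_zero_x : ∀ k, d 0 (x k) = 0
  d_succ_x : ∀ k l, d k.succ (x l) = if k = l then 1 else 0
  r : A
  r' : A
  r_mul : r * r' = 1
  d_succ_r : ∀ k, d (Fin.succ k) r = 0
  q : A
  q_mul : q * (1 + ∑ k, x k ^ 2) = 1

namespace Frame

variable {A : Type*} [CommRing A] [Algebra ℝ A] (F : Frame A)

theorem eq_zero_of_two_mul {a : A} (h : 2 * a = 0) : a = 0 := by
  have h1 : algebraMap ℝ A (1 / 2) * 2 = 1 := by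
    rw [← map_ofNat (algebraMap ℝ A) 2, ← map_mul]; norm_num
  linear_combination (algebraMap ℝ A (1 / 2)) * h - a * h1

theorem d_ofNat (i : Fin 4) (n : ℕ) [n.AtLeastTwo] : F.d i ofNat(n) = 0 := by
  rw [← Nat.cast_ofNat (R := A)]
  exact (F.d i).map_natCast _

theorem d_mul (i : Fin 4) (a b : A) : F.d i (a * b) = F.d i a * b + a * F.d i b := by
  rw [Derivation.leibniz, smul_eq_mul, smul_eq_mul]; ring

theorem d_sq (i : Fin 4) (a : A) : F.d i (a ^ 2) = 2 * a * F.d i a := by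
  rw [sq, d_mul]; ring

/-- The conformal factor `1 + |x|²`. -/
def S : A := 1 + ∑ k, F.x k ^ 2

/-- The components of the (diagonal) metric. -/
def g (i : Fin 4) : A := if i = 0 then F.r ^ 2 else -(4 * F.r ^ 2 * F.q ^ 2)

/-- The function `ρ = R' / R²`. -/
def rho : A := F.d 0 F.r * F.r' ^ 2

/-- The function `μ = R ρ'`, which is `1 - (2 R'² - R'' R + R²) / R²`. -/
def mu : A := F.r * F.d 0 F.rho

/-- Killing's equation for the contravariant components `v`, in the diagonal metric `g`. -/
structure Killing (v : Fin 4 → A) : Prop where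
  diag : ∀ i, ∑ s, v s * F.d s (F.g i) + 2 * F.g i * F.d i (v i) = 0
  off : ∀ i j, i ≠ j → F.g j * F.d i (v j) + F.g i * F.d j (v i) = 0

/-- The function `R V⁰`, which turns out to depend on the space coordinates only. -/
def pot (v : Fin 4 → A) : A := F.r * v 0

/-- The function `∂ₖVᵏ`, which for a Killing field is the same for `k = 1, 2, 3`. -/
def conf (v : Fin 4 → A) : A := F.d (Fin.succ 0) (v (Fin.succ 0))

theorem q_mul_S : F.q * F.S = 1 := F.q_mul

theorem d_S_zero : F.d 0 F.S = 0 := by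
  simp [S, map_sum, d_zero_x]

theorem d_S (k : Fin 3) : F.d k.succ F.S = 2 * F.x k := by
  simp [S, map_sum, d_succ_x]

theorem d_q (i : Fin 4) : F.d i F.q = -F.q ^ 2 * F.d i F.S := by
  have h := congrArg (F.d i) F.q_mul_S
  rw [d_mul, Derivation.map_one_eq_zero] at h
  linear_combination F.q * h - F.d i F.q * F.q_mul_S

theorem d_r' (i : Fin 4) : F.d i F.r' = -F.r' ^ 2 * F.d i F.r := by
  have h := congrArg (F.d i) F.r_mul
  rw [d_mul, Derivation.map_one_eq_zero] at h
  linear_combination F.r' * h - F.d i F.r' * F.r_mul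

theorem d_succ_rho (k : Fin 3) : F.d k.succ F.rho = 0 := by
  rw [rho, d_mul, d_sq, d_r', F.comm, d_succ_r, map_zero]; ring

theorem d_succ_mu (k : Fin 3) : F.d k.succ F.mu = 0 := by
  rw [mu, d_mul, F.comm, d_succ_r, d_succ_rho, map_zero]; ring

variable {F} {v : Fin 4 → A}

theorem eq_zero_of_S_mul {a : A} (h : F.S * a = 0) : a = 0 := by
  linear_combination F.q * h - a * F.q_mul_S

theorem eq_zero_of_r_mul {a : A} (h : F.r * a = 0) : a = 0 := by
  linear_combination F.r' * h - a * F.r_mul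

theorem eq_zero_of_q_mul {a : A} (h : F.q * a = 0) : a = 0 := by
  linear_combination F.S * h - a * F.q_mul_S

namespace Killing

theorem sum_eq_of_ne {B : Type*} [AddCommMonoid B] {a b c : Fin 3} (hab : a ≠ b) (hac : a ≠ c)
    (hbc : b ≠ c) (t : Fin 3 → B) :
    ∑ j, t j = t a + t b + t c := by
  have : (Finset.univ : Finset (Fin 3)) = {a, b, c} := by decide +revert
  rw [this, Finset.sum_insert (by simp [hab, hac]), Finset.sum_pair hbc, add_assoc]

/-- The time-time component of Killing's equation is `2 R ∂₀(R V⁰) = 0`. -/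
theorem d_zero_pot (h : F.Killing v) : F.d 0 (F.pot v) = 0 := by
  have h0 := h.diag 0
  simp only [Fin.sum_univ_succ (n := 3), g, if_true, d_sq, d_succ_r] at h0
  apply eq_zero_of_two_mul
  apply eq_zero_of_r_mul
  rw [pot, d_mul]
  simp at h0
  linear_combination h0

theorem d_zero (h : F.Killing v) (k : Fin 3) :
    4 * F.r * F.d 0 (v k.succ) = F.S ^ 2 * F.d k.succ (F.pot v) := by
  have h0 := h.off 0 k.succ (Fin.succ_ne_zero k).symm
  simp only [g, if_true, Fin.succ_ne_zero, if_false] at h0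
  rw [pot, d_mul, d_succ_r]
  linear_combination (-F.S ^ 2 * F.r') * h0
    + (F.S ^ 2 * F.r * F.d k.succ (v 0) - F.S ^ 2 * 4 * F.r * F.q ^ 2 * F.d 0 (v k.succ)) * F.r_mul
    - (4 * F.r * F.d 0 (v k.succ)) * (F.q * F.S + 1) * F.q_mul_S

theorem d_off (h : F.Killing v) {k l : Fin 3} (hkl : k ≠ l) :
    F.d k.succ (v l.succ) + F.d l.succ (v k.succ) = 0 := by
  have h0 := h.off k.succ l.succ (by simpa using hkl)
  simp only [g, Fin.succ_ne_zero, if_false] at h0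
  apply eq_zero_of_two_mul
  apply eq_zero_of_two_mul
  apply eq_zero_of_r_mul (F := F)
  apply eq_zero_of_r_mul (F := F)
  linear_combination (-F.S ^ 2) * h0 - 4 * F.r ^ 2 *
    (F.d k.succ (v l.succ) + F.d l.succ (v k.succ)) * (F.q * F.S + 1) * F.q_mul_S

/-- The diagonal space components of Killing's equation, divided by `-8 R² q³`. -/
theorem S_mul_d_diag (h : F.Killing v) (k : Fin 3) :
    F.S * (F.d k.succ (v k.succ) + F.rho * F.pot v) = 2 * ∑ j, F.x j * v j.succ := by
  have h0 := h.diag k.succ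
  simp only [Fin.sum_univ_succ (n := 3), g, Fin.succ_ne_zero, if_false, map_neg, d_mul, d_sq,
    d_succ_r, d_q, d_S_zero, d_S, d_ofNat] at h0
  have h1 : F.d k.succ (v k.succ) + F.rho * F.pot v - 2 * F.q * ∑ j, F.x j * v j.succ = 0 := by
    iterate 3 apply eq_zero_of_two_mul
    iterate 2 apply eq_zero_of_r_mul (F := F)
    iterate 2 apply eq_zero_of_q_mul (F := F)
    have e : ∑ j, F.x j * v j.succ = ∑ j : Fin 3, v j.succ * F.x j :=
      Finset.sum_congr rfl fun j _ => mul_comm _ _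
    have e2 : ∑ j : Fin 3, v j.succ *
        -((0 * F.r ^ 2 + 4 * (2 * F.r * 0)) * F.q ^ 2
          + 4 * F.r ^ 2 * (2 * F.q * (-F.q ^ 2 * (2 * F.x j))))
        = 16 * F.r ^ 2 * F.q ^ 3 * ∑ j : Fin 3, v j.succ * F.x j := by
      rw [Finset.mul_sum]
      exact Finset.sum_congr rfl fun j _ => by ring
    rw [e2] at h0
    rw [e, rho, pot]
    linear_combination (-1) * h0 + 8 * F.r * F.d 0 F.r * v 0 * F.q ^ 2 * (F.r * F.r' + 1) * F.r_mul
  linear_combination F.S * h1 + 2 * (∑ j, F.x j * v j.succ) * F.q_mul_S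

theorem d_diag (h : F.Killing v) (k : Fin 3) : F.d k.succ (v k.succ) = F.conf v := by
  have e := (h.S_mul_d_diag k).trans (h.S_mul_d_diag 0).symm
  rw [← sub_eq_zero]
  apply eq_zero_of_S_mul (F := F)
  rw [conf]
  linear_combination e

theorem S_mul_conf (h : F.Killing v) :
    F.S * (F.conf v + F.rho * F.pot v) = 2 * ∑ j, F.x j * v j.succ := h.S_mul_d_diag 0

theorem d_d_conf_of_ne (h : F.Killing v) {a b c : Fin 3} (hab : a ≠ b) (hac : a ≠ c)
    (hbc : b ≠ c) : F.d a.succ (F.d b.succ (F.conf v)) = 0 := by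
  apply eq_zero_of_two_mul
  have key (a b : Fin 3) (hbc : b ≠ c) : F.d a.succ (F.d b.succ (F.conf v))
      = -F.d c.succ (F.d c.succ (F.d a.succ (v b.succ))) := by
    rw [← h.d_diag c, F.comm b.succ c.succ, eq_neg_of_add_eq_zero_left (h.d_off hbc), map_neg,
      map_neg, F.comm a.succ c.succ, F.comm a.succ c.succ]
  have e := congrArg (fun t => F.d c.succ (F.d c.succ t)) (h.d_off hab)
  simp only [map_add, map_zero] at e
  linear_combination key a b hbc + F.comm a.succ b.succ (F.conf v) + key b a hac - e

theorem d_d_conf_self_add (h : F.Killing v) {a b : Fin 3} (hab : a ≠ b) :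
    F.d a.succ (F.d a.succ (F.conf v)) + F.d b.succ (F.d b.succ (F.conf v)) = 0 := by
  have e1 := congrArg (fun t => F.d a.succ (F.d b.succ t)) (h.d_off hab)
  simp only [map_add, map_zero] at e1
  rw [F.comm b.succ a.succ (v b.succ), h.d_diag, F.comm a.succ b.succ (F.d b.succ (v a.succ)),
    F.comm a.succ b.succ (v a.succ), h.d_diag] at e1
  exact e1

theorem d_d_conf_self (h : F.Killing v) (a : Fin 3) :
    F.d a.succ (F.d a.succ (F.conf v)) = 0 := by
  have hb : ∃ b c : Fin 3, a ≠ b ∧ a ≠ c ∧ b ≠ c := by decide +revert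
  obtain ⟨b, c, hab, hac, hbc⟩ := hb
  apply eq_zero_of_two_mul
  linear_combination h.d_d_conf_self_add hab + h.d_d_conf_self_add hac - h.d_d_conf_self_add hbc

/-- The conformal factor of a conformal field of flat three-space is affine. -/
theorem d_d_conf (h : F.Killing v) (a b : Fin 3) : F.d a.succ (F.d b.succ (F.conf v)) = 0 := by
  by_cases hab : a = b
  · rw [hab, h.d_d_conf_self]
  · have hc : ∃ c : Fin 3, a ≠ c ∧ b ≠ c := by decide +revert
    obtain ⟨c, hac, hbc⟩ := hc
    exact h.d_d_conf_of_ne hab hac hbc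

/-- The time derivative of `∂ₖVˡ + ∂ₗVᵏ = 0`: the off-diagonal part of `Hess f = -μ f σ` for
`f = R V⁰`, in flat coordinates. -/
theorem S_mul_hess_off (h : F.Killing v) {k l : Fin 3} (hkl : k ≠ l) :
    F.S * F.d k.succ (F.d l.succ (F.pot v))
      = -2 * (F.x k * F.d l.succ (F.pot v) + F.x l * F.d k.succ (F.pot v)) := by
  have e (k l : Fin 3) : 4 * F.r * F.d 0 (F.d l.succ (v k.succ)) = 4 * F.S * F.x l *
      F.d k.succ (F.pot v) + F.S ^ 2 * F.d l.succ (F.d k.succ (F.pot v)) := by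
    have e := congrArg (F.d l.succ) (h.d_zero k)
    simp only [d_mul, d_sq, d_S, d_succ_r, d_ofNat] at e
    rw [F.comm l.succ 0] at e
    linear_combination e
  have e3 := congrArg (F.d 0) (h.d_off hkl)
  simp only [map_add, map_zero] at e3
  rw [← sub_eq_zero]
  apply eq_zero_of_two_mul
  apply eq_zero_of_S_mul (F := F)
  linear_combination 4 * F.r * e3 - e k l - e l k
    + F.S ^ 2 * F.comm k.succ l.succ (F.pot v)

/-- The time derivative of `S (∂ₖVᵏ + ρ f) = 2 x · V`: the diagonal part of `Hess f = -μ f σ`. -/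
theorem S_sq_mul_hess_diag (h : F.Killing v) (k : Fin 3) :
    F.S ^ 2 * F.d k.succ (F.d k.succ (F.pot v))
      = 2 * F.S * ∑ j, F.x j * F.d j.succ (F.pot v) - 4 * F.mu * F.pot v
        - 4 * F.S * F.x k * F.d k.succ (F.pot v) := by
  have e1 := congrArg (F.d k.succ) (h.d_zero k)
  simp only [d_mul, d_sq, d_S, d_succ_r, d_ofNat] at e1
  rw [F.comm k.succ 0, h.d_diag] at e1
  have e2 := congrArg (F.d 0) h.S_mul_conf
  simp only [d_mul, d_S_zero, d_ofNat, map_sum, map_add, d_zero_x, h.d_zero_pot] at e2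
  have e3 : 4 * F.r * ∑ j, (0 * v j.succ + F.x j * F.d 0 (v j.succ))
      = F.S ^ 2 * ∑ j, F.x j * F.d j.succ (F.pot v) := by
    rw [Finset.mul_sum, Finset.mul_sum]
    exact Finset.sum_congr rfl fun j _ => by linear_combination F.x j * h.d_zero j
  rw [← sub_eq_zero]
  apply eq_zero_of_S_mul (F := F)
  rw [mu]
  linear_combination -F.S * e1 + 4 * F.r * e2 + 2 * e3

/-- The Hessian of `R V⁰` does not depend on time, hence neither does `μ` where `V⁰ ≠ 0`. -/
theorem d_zero_mu_mul_pot (h : F.Killing v) : F.d 0 F.mu * F.pot v = 0 := by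
  have e := congrArg (F.d 0) (h.S_sq_mul_hess_diag 0)
  simp only [d_mul, d_sq, d_S_zero, d_ofNat, map_sum, map_sub, d_zero_x, h.d_zero_pot,
    F.comm 0 (Fin.succ _), map_zero] at e
  apply eq_zero_of_two_mul
  apply eq_zero_of_two_mul
  simp at e
  linear_combination e

/-- The integrability condition `[∂_a, ∂_b] ∂_a f = 0` for `f = R V⁰`. -/
theorem mu_sub_one_mul_d_pot (h : F.Killing v) (b : Fin 3) :
    (F.mu - 1) * F.d b.succ (F.pot v) = 0 := by
  have hb : ∃ a c : Fin 3, a ≠ b ∧ a ≠ c ∧ b ≠ c := by decide +revert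
  obtain ⟨a, c, hab, hac, hbc⟩ := hb
  have hsum := sum_eq_of_ne (B := A) hab hac hbc
  have hS : F.S = 1 + (F.x a ^ 2 + F.x b ^ 2 + F.x c ^ 2) := by rw [S, hsum]
  have haa := h.S_sq_mul_hess_diag a
  have hbb := h.S_sq_mul_hess_diag b
  have hab' := h.S_mul_hess_off hab
  have hbc' := h.S_mul_hess_off hbc
  have e1 := congrArg (F.d b.succ) haa
  have e2 := congrArg (F.d a.succ) hab'
  rw [hsum] at e1 haa hbb
  simp only [d_mul, d_sq, d_S, d_succ_x, d_ofNat, map_sub, map_add, map_neg, d_succ_mu, hab,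
    hab.symm, hbc, if_true, if_false] at e1 e2
  rw [F.comm b.succ a.succ (F.d a.succ _), F.comm b.succ a.succ] at e1
  iterate 2 apply eq_zero_of_two_mul
  apply eq_zero_of_S_mul (F := F)
  linear_combination F.S * e1 - F.S ^ 2 * e2 - 2 * F.x b * (haa - hbb) + 2 * F.S * F.x a * hab'
    + 2 * F.S * F.x c * hbc' + 4 * F.S * F.d b.succ (F.pot v) * hS

theorem d_S_mul_conf (h : F.Killing v) (k : Fin 3) :
    2 * F.x k * (F.conf v + F.rho * F.pot v)
        + F.S * (F.d k.succ (F.conf v) + F.rho * F.d k.succ (F.pot v))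
      = 2 * (v k.succ + ∑ j, F.x j * F.d k.succ (v j.succ)) := by
  have e := congrArg (F.d k.succ) h.S_mul_conf
  simp only [d_mul, d_S, map_add, map_sum, d_succ_rho, d_succ_x, d_ofNat, Finset.sum_add_distrib,
    ite_mul, one_mul, zero_mul, Finset.sum_ite_eq, Finset.mem_univ, if_true] at e
  linear_combination e

/-- The conformal factor of a conformal field of the round sphere is an eigenfunction of the
Hessian with eigenvalue `-1`, and here it is `-ρ R V⁰`. -/
theorem rho_mul_one_sub_mu_mul_pot (h : F.Killing v) : F.rho * (1 - F.mu) * F.pot v = 0 := by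
  have hsum (t : Fin 3 → A) := sum_eq_of_ne (B := A) (a := 0) (b := 1) (c := 2)
    (by decide) (by decide) (by decide) t
  have hS : F.S = 1 + (F.x 0 ^ 2 + F.x 1 ^ 2 + F.x 2 ^ 2) := by rw [S, hsum]
  have h0 := h.S_mul_conf
  have hd := h.d_S_mul_conf
  have e := congrArg (F.d (Fin.succ 0)) (hd 0)
  have hh := h.S_sq_mul_hess_diag 0
  have haa (b : Fin 3) (hb : 0 ≠ b) : F.d (Fin.succ 0) (F.d (Fin.succ 0) (v b.succ))
      = -F.d b.succ (F.conf v) := by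
    rw [eq_neg_of_add_eq_zero_left (h.d_off hb), map_neg, F.comm, h.d_diag]
  have haa0 := congrArg (F.d (Fin.succ 0)) (h.d_diag 0)
  have haa1 := haa 1 (by decide)
  have haa2 := haa 2 (by decide)
  have hd0 := hd 0
  have hd1 := hd 1
  have hd2 := hd 2
  have t0 := h.d_diag 0
  have t1 := h.d_diag 1
  have t2 := h.d_diag 2
  have o01 := h.d_off (k := 0) (l := 1) (by decide)
  have o02 := h.d_off (k := 0) (l := 2) (by decide)
  have o12 := h.d_off (k := 1) (l := 2) (by decide)
  rw [hsum] at h0 hd0 hd1 hd2 hh e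
  simp only [d_mul, d_S, map_add, d_succ_rho, d_succ_x, d_ofNat, h.d_d_conf, ↓reduceIte,
    Fin.reduceEq] at e
  have hP : 2 * F.S * (F.rho * F.pot v) + 2 * F.S * F.rho * (F.x 0 * F.d (Fin.succ 0) (F.pot v)
        + F.x 1 * F.d (Fin.succ 1) (F.pot v) + F.x 2 * F.d (Fin.succ 2) (F.pot v))
      - 4 * F.rho * F.mu * F.pot v - 2 * F.S * F.conf v
      + 2 * F.S * (F.x 0 * F.d (Fin.succ 0) (F.conf v)
        + F.x 1 * F.d (Fin.succ 1) (F.conf v) + F.x 2 * F.d (Fin.succ 2) (F.conf v)) = 0 := by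
    linear_combination F.S * e - F.rho * hh
      + F.S * (2 * F.x 0 * haa0 + 2 * F.x 1 * haa1 + 2 * F.x 2 * haa2 + 4 * t0)
  -- Euler's radial derivative of `S (T + ρ f) = 2 x · V`, with the skew part of `∂V` dropping out
  have hZ : F.S * (F.x 0 * F.d (Fin.succ 0) (F.conf v)
        + F.x 1 * F.d (Fin.succ 1) (F.conf v) + F.x 2 * F.d (Fin.succ 2) (F.conf v) - F.conf v)
      + F.S * F.rho * (F.x 0 * F.d (Fin.succ 0) (F.pot v)
        + F.x 1 * F.d (Fin.succ 1) (F.pot v) + F.x 2 * F.d (Fin.succ 2) (F.pot v))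
      + (2 * (F.x 0 ^ 2 + F.x 1 ^ 2 + F.x 2 ^ 2) - F.S) * (F.rho * F.pot v) = 0 := by
    linear_combination F.x 0 * hd0 + F.x 1 * hd1 + F.x 2 * hd2 - h0
      + 2 * (F.x 0 ^ 2 * t0 + F.x 1 ^ 2 * t1 + F.x 2 ^ 2 * t2
        + F.x 0 * F.x 1 * o01 + F.x 0 * F.x 2 * o02 + F.x 1 * F.x 2 * o12)
  iterate 2 apply eq_zero_of_two_mul
  linear_combination hP - 2 * hZ - 4 * F.rho * F.pot v * hS

theorem d_zero_eq_zero (h : F.Killing v) (h0 : v 0 = 0) (k : Fin 3) : F.d 0 (v k.succ) = 0 := by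
  have e := h.d_zero k
  rw [pot, h0, mul_zero, map_zero, mul_zero] at e
  iterate 2 apply eq_zero_of_two_mul
  apply eq_zero_of_r_mul (F := F)
  linear_combination e

theorem d_d_conf_of_zero (h : F.Killing v) (h0 : v 0 = 0) (i : Fin 4) (k : Fin 3) :
    F.d i (F.d k.succ (F.conf v)) = 0 := by
  cases i using Fin.cases with
  | zero =>
    rw [F.comm, conf, F.comm 0, h.d_zero_eq_zero h0, map_zero, map_zero]
  | succ i => exact h.d_d_conf i k

/-- If `∂ₖVᵏ = 0` then `∂ᵢ∂ⱼVᵏ` is symmetric in `i, j` and skew in `j, k`, so it vanishes. -/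
theorem d_d_eq_zero (h : F.Killing v) (h0 : v 0 = 0) (hc : F.conf v = 0) (i : Fin 4)
    (j k : Fin 3) : F.d i (F.d j.succ (v k.succ)) = 0 := by
  cases i using Fin.cases with
  | zero => rw [F.comm, h.d_zero_eq_zero h0, map_zero]
  | succ i =>
    have skew (i j k : Fin 3) : F.d i.succ (F.d j.succ (v k.succ))
        = -F.d i.succ (F.d k.succ (v j.succ)) := by
      by_cases hjk : j = k
      · rw [hjk, h.d_diag, hc, map_zero, neg_zero]
      · rw [eq_neg_of_add_eq_zero_left (h.d_off hjk), map_neg]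
    apply eq_zero_of_two_mul
    linear_combination skew i j k - F.comm i.succ k.succ (v j.succ) - skew k i j
      + F.comm k.succ j.succ (v i.succ) + skew j k i - F.comm j.succ i.succ (v k.succ)

end Killing

theorem mu_eq : F.mu = F.r' * F.d 0 (F.d 0 F.r) - 2 * F.r' ^ 2 * F.d 0 F.r ^ 2 := by
  rw [mu, rho, d_mul, d_sq, d_r']
  linear_combination (F.r' * F.d 0 (F.d 0 F.r) - 2 * F.r' ^ 2 * F.d 0 F.r ^ 2) * F.r_mul

theorem d_zero_g_succ (k : Fin 3) : F.d 0 (F.g k.succ) = 2 * (F.d 0 F.r * F.r') * F.g k.succ := by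
  simp only [g, Fin.succ_ne_zero, if_false, map_neg, d_mul, d_sq, d_q, d_S_zero, d_ofNat]
  linear_combination (8 * F.r * F.q ^ 2 * F.d 0 F.r) * F.r_mul

end Frame
/-! ### The frame of a chart -/

theorem isOpen_dom {I : Set ℝ} (hI : IsOpen I) : IsOpen (dom I) :=
  hI.preimage (continuous_apply 0)

theorem isPreconnected_dom {I : Set ℝ} (hI : IsPreconnected I) : IsPreconnected (dom I) := by
  have : Convex ℝ (dom I) := hI.convex.is_linear_preimage
    (f := fun x : Coord => x 0) ⟨fun _ _ => rfl, fun _ _ => rfl⟩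
  exact this.isPreconnected

theorem pd_coord (i j : Fin 4) (x : Coord) : pd i (fun y => y j) x = if i = j then 1 else 0 := by
  have h := (hasFDerivAt_apply (𝕜 := ℝ) j x).fderiv
  unfold pd
  rw [h]
  simp [Pi.single_apply, eq_comm]

theorem pd_comp_time {φ : ℝ → ℝ} {x : Coord} (hφ : DifferentiableAt ℝ φ (x 0)) (i : Fin 4) :
    pd i (fun y => φ (y 0)) x = if i = 0 then deriv φ (x 0) else 0 := by
  have h := (hφ.hasDerivAt.comp_hasFDerivAt x (hasFDerivAt_apply (𝕜 := ℝ) (0 : Fin 4) x)).fderiv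
  unfold pd
  rw [show (fun y : Coord => φ (y 0)) = φ ∘ fun y => y 0 from rfl, h]
  simp [Pi.single_apply, eq_comm]

theorem spaceSq_add_one_pos (x : Coord) : 0 < spaceSq x + 1 := by
  unfold spaceSq; positivity

theorem contDiff_coord (i : Fin 4) : ContDiff ℝ ∞ fun y : Coord => y i := by fun_prop

theorem contDiffOn_comp_time {I : Set ℝ} {φ : ℝ → ℝ} (hφ : ContDiffOn ℝ ∞ φ I) :
    ContDiffOn ℝ ∞ (fun y : Coord => φ (y 0)) (dom I) :=
  hφ.comp (contDiff_coord 0).contDiffOn fun _ hx => hx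

section

variable {I : Set ℝ} (hI : IsOpen I) {R : ℝ → ℝ} (hR : ContDiffOn ℝ ∞ R I)
  (hpos : ∀ t ∈ I, 0 < R t)

/-- The frame of smooth functions on either chart of `I × S³`. -/
noncomputable def chartFrame : Frame (smoothAlg (dom I)) where
  d := partialDer (isOpen_dom hI)
  comm := partialDer_comm (isOpen_dom hI)
  x k := restrict (fun y => y k.succ) (contDiff_coord k.succ).contDiffOn
  d_zero_x k := smoothAlg_ext fun x => by
    rw [evalAt_partialDer_of_eq (isOpen_dom hI) 0 (fun _ => evalAt_restrict _ _ _), pd_coord,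
      if_neg (Fin.succ_ne_zero k).symm, map_zero]
  d_succ_x k l := smoothAlg_ext fun x => by
    rw [evalAt_partialDer_of_eq (isOpen_dom hI) _ (fun _ => evalAt_restrict _ _ _), pd_coord]
    split_ifs <;> simp_all
  r := restrict (fun y => R (y 0)) (contDiffOn_comp_time hR)
  r' := restrict (fun y => (R (y 0))⁻¹)
    (contDiffOn_comp_time (φ := fun t => (R t)⁻¹) (hR.inv fun t ht => (hpos t ht).ne'))
  r_mul := smoothAlg_ext fun x => by
    simp [(hpos _ x.2).ne']
  d_succ_r k := smoothAlg_ext fun x => by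
    rw [evalAt_partialDer_of_eq (isOpen_dom hI) _ (fun _ => evalAt_restrict _ _ _),
      pd_comp_time, if_neg (Fin.succ_ne_zero k), map_zero]
    exact (hR.differentiableOn (by simp)).differentiableAt (hI.mem_nhds x.2)
  q := restrict (fun y => (spaceSq y + 1)⁻¹) (by
    have h : ContDiff ℝ ∞ fun y => spaceSq y + 1 := by unfold spaceSq; fun_prop
    exact (h.inv fun y => (spaceSq_add_one_pos y).ne').contDiffOn)
  q_mul := smoothAlg_ext fun x => by
    have h : (1 : ℝ) + ∑ k : Fin 3, (x.1 k.succ) ^ 2 = spaceSq x + 1 := by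
      simp [Fin.sum_univ_three, spaceSq]; ring
    simp [map_sum, h, (spaceSq_add_one_pos x).ne']

/-- The components of a smooth vector field in a chart. -/
noncomputable def components {V : Coord → Coord} (hV : ContDiffOn ℝ ∞ V (dom I)) (i : Fin 4) :
    smoothAlg (dom I) :=
  restrict (fun y => V y i) (contDiffOn_pi.1 hV i)

local notation "𝓕" => chartFrame hI hR hpos

theorem evalAt_d_of_eq (i : Fin 4) {a : smoothAlg (dom I)}
    {f : Coord → ℝ} (h : ∀ x : dom I, evalAt x a = f x) (x : dom I) :
    evalAt x ((𝓕).d i a) = pd i f x :=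
  evalAt_partialDer_of_eq (isOpen_dom hI) i h x

theorem evalAt_g (i : Fin 4) (x : dom I) : evalAt x ((𝓕).g i) = metric R x i i := by
  have hr : evalAt x (𝓕).r = R (x.1 0) := rfl
  have hq : evalAt x (𝓕).q = (spaceSq x.1 + 1)⁻¹ := rfl
  have := (spaceSq_add_one_pos x).ne'
  unfold Frame.g metric
  split_ifs with h <;> simp [h, hr, hq, map_ofNat]
  field_simp

theorem metric_of_ne (x : Coord) {i j : Fin 4} (h : i ≠ j) : metric R x i j = 0 := by
  simp [metric, h]

theorem pd_metric (s i j : Fin 4) (x : dom I) : pd s (fun y => metric R y i j) x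
    = if i = j then evalAt x ((𝓕).d s ((𝓕).g i)) else 0 := by
  split_ifs with h
  · rw [← h, evalAt_d_of_eq hI hR hpos s (f := fun y => metric R y i i) (evalAt_g hI hR hpos i)]
  · simp only [metric_of_ne _ h]
    simp [pd]

variable {V : Coord → Coord} (hV : ContDiffOn ℝ ∞ V (dom I))

theorem evalAt_components (i : Fin 4) (x : dom I) : evalAt x (components hV i) = V x i := rfl

theorem evalAt_d_components (i j : Fin 4) (x : dom I) :
    evalAt x ((𝓕).d i (components hV j)) = pd i (fun y => V y j) x :=
  evalAt_d_of_eq hI hR hpos i (evalAt_components hV j) x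

theorem lieMetric_self (i : Fin 4) (x : dom I) : lieMetric R V x i i
    = evalAt x (∑ s, components hV s * (𝓕).d s ((𝓕).g i)
      + 2 * (𝓕).g i * (𝓕).d i (components hV i)) := by
  unfold lieMetric
  rw [Finset.sum_eq_single (f := fun s => metric R x s i * _) i (fun s _ h => by
      simp [metric_of_ne _ h]) (by simp),
    Finset.sum_eq_single (f := fun s => metric R x i s * _) i (fun s _ h => by
      simp [metric_of_ne _ h.symm]) (by simp)]
  simp only [pd_metric hI hR hpos, if_true, map_add, map_sum, map_mul, map_ofNat, evalAt_g,
    evalAt_d_components, evalAt_components]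
  ring

theorem lieMetric_of_ne {i j : Fin 4} (hij : i ≠ j) (x : dom I) : lieMetric R V x i j
    = evalAt x ((𝓕).g j * (𝓕).d i (components hV j) + (𝓕).g i * (𝓕).d j (components hV i)) := by
  unfold lieMetric
  rw [Finset.sum_eq_single (f := fun s => metric R x s j * _) j (fun s _ h => by
      simp [metric_of_ne _ h]) (by simp),
    Finset.sum_eq_single (f := fun s => metric R x i s * _) i (fun s _ h => by
      simp [metric_of_ne _ h.symm]) (by simp)]
  simp [pd_metric hI hR hpos, hij, evalAt_g, evalAt_d_components]

theorem killing_components_iff : (𝓕).Killing (components hV) ↔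
    ∀ x ∈ dom I, ∀ i j, lieMetric R V x i j = 0 := by
  constructor
  · intro h x hx i j
    by_cases hij : i = j
    · rw [← hij, lieMetric_self hI hR hpos hV i ⟨x, hx⟩, h.diag, map_zero]
    · rw [lieMetric_of_ne hI hR hpos hV hij ⟨x, hx⟩, h.off i j hij, map_zero]
  · intro h
    refine ⟨fun i => smoothAlg_ext fun x => ?_, fun i j hij => smoothAlg_ext fun x => ?_⟩
    · rw [← lieMetric_self hI hR hpos hV i x, h x x.2, map_zero]
    · rw [← lieMetric_of_ne hI hR hpos hV hij x, h x x.2, map_zero]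

theorem lower_eq (i : Fin 4) (x : Coord) : lower R V i x = metric R x i i * V x i :=
  Finset.sum_eq_single i (fun s _ h => by simp [metric_of_ne _ h.symm]) (by simp)

theorem evalAt_d_r (x : dom I) : evalAt x ((𝓕).d 0 (𝓕).r) = deriv R (x.1 0) := by
  rw [evalAt_d_of_eq hI hR hpos 0 (f := fun y => R (y 0)) fun _ => rfl,
    pd_comp_time ((hR.differentiableOn (by simp)).differentiableAt (hI.mem_nhds x.2)), if_pos rfl]

theorem contDiffOn_deriv {φ : ℝ → ℝ} (hI : IsOpen I) (hφ : ContDiffOn ℝ ∞ φ I) :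
    ContDiffOn ℝ ∞ (deriv φ) I := hφ.deriv_of_isOpen hI (by simp)

theorem differentiableAt_of_mem {φ : ℝ → ℝ} (hI : IsOpen I) (hφ : ContDiffOn ℝ ∞ φ I) {t : ℝ}
    (ht : t ∈ I) : DifferentiableAt ℝ φ t :=
  (hφ.differentiableOn (by simp)).differentiableAt (hI.mem_nhds ht)

theorem evalAt_d_d_r (x : dom I) :
    evalAt x ((𝓕).d 0 ((𝓕).d 0 (𝓕).r)) = deriv (deriv R) (x.1 0) := by
  rw [evalAt_d_of_eq hI hR hpos 0 (f := fun y => deriv R (y 0)) (evalAt_d_r hI hR hpos),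
    pd_comp_time (differentiableAt_of_mem hI (contDiffOn_deriv hI hR) x.2), if_pos rfl]

theorem evalAt_d_d_d_r (x : dom I) :
    evalAt x ((𝓕).d 0 ((𝓕).d 0 ((𝓕).d 0 (𝓕).r))) = deriv (deriv (deriv R)) (x.1 0) := by
  rw [evalAt_d_of_eq hI hR hpos 0 (f := fun y => deriv (deriv R) (y 0)) (evalAt_d_d_r hI hR hpos),
    pd_comp_time (differentiableAt_of_mem hI (contDiffOn_deriv hI (contDiffOn_deriv hI hR)) x.2),
    if_pos rfl]

theorem evalAt_mu (x : dom I) :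
    evalAt x (𝓕).mu = 1 - excess R (x.1 0) / R (x.1 0) ^ 2 := by
  have hr' : evalAt x (𝓕).r' = (R (x.1 0))⁻¹ := rfl
  have h0 := (hpos _ x.2).ne'
  simp only [Frame.mu_eq, map_sub, map_mul, map_pow, evalAt_d_r, evalAt_d_d_r, hr', map_ofNat,
    excess]
  field_simp
  ring

theorem evalAt_d_mu (x : dom I) : evalAt x ((𝓕).d 0 (𝓕).mu)
    = (4 * deriv R (x.1 0) ^ 3 - 5 * deriv (deriv R) (x.1 0) * deriv R (x.1 0) * R (x.1 0)
      + deriv (deriv (deriv R)) (x.1 0) * R (x.1 0) ^ 2) / R (x.1 0) ^ 3 := by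
  have hr' : evalAt x (𝓕).r' = (R (x.1 0))⁻¹ := rfl
  have h0 := (hpos _ x.2).ne'
  simp only [Frame.mu_eq, map_sub, map_mul, map_pow, evalAt_d_r, evalAt_d_d_r, hr', map_ofNat,
    Frame.d_mul, Frame.d_sq, Frame.d_r', Frame.d_ofNat, map_add, map_neg, evalAt_d_d_d_r, map_zero]
  field_simp
  ring

theorem evalAt_rho (x : dom I) : evalAt x (𝓕).rho = deriv R (x.1 0) / R (x.1 0) ^ 2 := by
  have hr' : evalAt x (𝓕).r' = (R (x.1 0))⁻¹ := rfl
  simp only [Frame.rho, map_mul, map_pow, evalAt_d_r, hr']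
  field_simp

theorem lower_zero_eq (x : dom I) :
    lower R V 0 x = R (x.1 0) * evalAt x ((𝓕).pot (components hV)) := by
  have hr : evalAt x (𝓕).r = R (x.1 0) := rfl
  rw [lower_eq, Frame.pot, map_mul, evalAt_components, hr]
  simp [metric]; ring

theorem metric_ne_zero {x : Coord} (h0 : R (x 0) ≠ 0) (i : Fin 4) : metric R x i i ≠ 0 := by
  have := (spaceSq_add_one_pos x).ne'
  simp only [metric, Matrix.diagonal_apply_eq]
  split_ifs <;> simp [h0, this]

theorem metric_inv_apply {x : Coord} (h0 : R (x 0) ≠ 0) (i j : Fin 4) :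
    (metric R x)⁻¹ i j = if i = j then (metric R x i i)⁻¹ else 0 := by
  have h : metric R x * Matrix.diagonal (fun i => (metric R x i i)⁻¹) = 1 := by
    rw [← Matrix.diagonal_one]
    ext i j
    rw [Matrix.mul_diagonal, Matrix.diagonal_apply]
    split_ifs with hij
    · rw [← hij, mul_inv_cancel₀ (metric_ne_zero h0 i)]
    · rw [metric_of_ne _ hij, zero_mul]
  rw [Matrix.inv_eq_right_inv h, Matrix.diagonal_apply]

theorem christoffel_zero_succ {I : Set ℝ} (hI : IsOpen I) {R : ℝ → ℝ}
    (hR : ContDiffOn ℝ ∞ R I) (hpos : ∀ t ∈ I, 0 < R t) (m : Fin 4) (k : Fin 3) (x : dom I) :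
    christoffel R m 0 k.succ x = if m = k.succ then deriv R (x.1 0) / R (x.1 0) else 0 := by
  have hr' : evalAt x (chartFrame hI hR hpos).r' = (R (x.1 0))⁻¹ := rfl
  have h0 := (hpos _ x.2).ne'
  have hinv := metric_inv_apply h0 m
  have hm := metric_ne_zero h0 m
  unfold christoffel
  rw [Finset.sum_eq_single m (fun s _ h => by simp [hinv, h.symm]) (by simp), hinv, if_pos rfl]
  simp only [pd_metric hI hR hpos]
  rw [if_neg (Fin.succ_ne_zero k).symm]
  by_cases h : m = k.succ
  · subst h
    rw [if_neg (Fin.succ_ne_zero k).symm, if_pos rfl, if_pos rfl, Frame.d_zero_g_succ, map_mul,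
      evalAt_g, map_mul, map_mul, evalAt_d_r, hr', map_ofNat]
    field_simp
    ring
  · rw [if_neg h, if_neg h]
    have : (chartFrame hI hR hpos).d k.succ ((chartFrame hI hR hpos).g 0) = 0 := by
      simp [Frame.g, Frame.d_succ_r]
    split_ifs with h0
    · rw [this]; simp
    · simp

theorem compatibilityAt (h : (𝓕).Killing (components hV)) (x : dom I) :
    CompatibilityAt R V x := by
  have hr : evalAt x (𝓕).r = R (x.1 0) := rfl
  have h0 := (hpos _ x.2).ne'
  have e1 := congrArg (evalAt x) h.d_zero_mu_mul_pot
  have e2 := congrArg (evalAt x) h.rho_mul_one_sub_mu_mul_pot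
  simp only [map_mul, map_sub, map_one, map_zero, evalAt_d_mu, evalAt_mu, evalAt_rho] at e1 e2
  refine ⟨?_, ?_, fun k hk => ?_⟩
  · rw [lower_zero_eq hI hR hpos hV]
    rw [div_mul_eq_mul_div, div_eq_zero_iff, or_iff_left (pow_ne_zero 3 h0)] at e1
    rw [mul_left_comm, e1, mul_zero]
  · rw [lower_zero_eq hI hR hpos hV]
    rw [show deriv R (x.1 0) * excess R (x.1 0)
        * (R (x.1 0) * evalAt x ((𝓕).pot (components hV)))
      = R (x.1 0) ^ 5 * (deriv R (x.1 0) / R (x.1 0) ^ 2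
        * (1 - (1 - excess R (x.1 0) / R (x.1 0) ^ 2))
        * evalAt x ((𝓕).pot (components hV))) by field_simp; ring, e2, mul_zero]
  · obtain ⟨k, rfl⟩ := Fin.exists_succ_eq.2 hk
    have e3 := congrArg (evalAt x) (h.mu_sub_one_mul_d_pot k)
    have e4 := congrArg (evalAt x) (h.d_zero k)
    have hS : evalAt x (𝓕).S = spaceSq x.1 + 1 := by
      have hx (k : Fin 3) : evalAt x ((𝓕).x k) = x.1 k.succ := rfl
      simp [Frame.S, hx, Fin.sum_univ_three, spaceSq]
      ring
    have hr' : evalAt x (𝓕).r' = (R (x.1 0))⁻¹ := rfl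
    have hl (y : dom I) : evalAt y ((𝓕).g k.succ * components hV k.succ) = lower R V k.succ y := by
      rw [lower_eq, map_mul, evalAt_g, evalAt_components]
    have hc : covDeriv R V 0 k.succ x = evalAt x ((𝓕).d 0 ((𝓕).g k.succ * components hV k.succ))
        - deriv R (x.1 0) / R (x.1 0) * lower R V k.succ x := by
      unfold covDeriv
      rw [evalAt_d_of_eq hI hR hpos 0 hl]
      simp [christoffel_zero_succ hI hR hpos]
    rw [hc, lower_eq, Frame.d_mul, Frame.d_zero_g_succ]
    simp only [map_mul, map_sub, map_one, map_zero, map_add, evalAt_mu, map_ofNat, evalAt_d_r,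
      evalAt_g, evalAt_components, map_pow, hS, hr, hr'] at e3 e4 ⊢
    set w := evalAt x ((𝓕).d 0 (components hV k.succ))
    set p := evalAt x ((𝓕).d k.succ ((𝓕).pot (components hV)))
    have e5 : excess R (x.1 0) * p = 0 := by
      field_simp at e3
      linear_combination -e3
    have e6 : R (x.1 0) * (excess R (x.1 0) * w) = 0 := by
      linear_combination (excess R (x.1 0) * e4 + (spaceSq x.1 + 1) ^ 2 * e5) / 4
    field_simp
    linear_combination -metric R x k.succ k.succ * e6

end

/-! ### Killing fields with a time component -/

/-- A function with `∂₀a = 0` is constant along time lines, since `I` is connected. -/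
theorem evalAt_eq_of_d_zero {I : Set ℝ} (hI : IsOpen I) (hc : IsPreconnected I) {R : ℝ → ℝ}
    (hR : ContDiffOn ℝ ∞ R I) (hpos : ∀ t ∈ I, 0 < R t) {a : smoothAlg (dom I)}
    (h : (chartFrame hI hR hpos).d 0 a = 0) (x : dom I) {t : ℝ} (ht : t ∈ I) :
    evalAt ⟨Function.update x 0 t, by simpa [dom] using ht⟩ a = evalAt x a := by
  have hd (s : ℝ) (hs : s ∈ I) :
      HasDerivAt (fun s => zeroExt a.1 (Function.update x.1 0 s)) 0 s := by
    have hs' : Function.update x.1 0 s ∈ dom I := by simpa [dom] using hs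
    have h1 := (differentiableAt_zeroExt (isOpen_dom hI) a ⟨_, hs'⟩).hasFDerivAt
    have h2 := h1.comp_hasDerivAt s (hasDerivAt_update x.1 0 s)
    have h3 : evalAt ⟨_, hs'⟩ ((chartFrame hI hR hpos).d 0 a) = 0 := by rw [h, map_zero]
    rw [show fderiv ℝ (zeroExt a.1) (Function.update x.1 0 s) (Pi.single 0 1) = 0 from h3] at h2
    exact h2
  have h1 := hI.is_const_of_deriv_eq_zero (𝕜 := ℝ) hc
    (f := fun s => zeroExt a.1 (Function.update x.1 0 s))
    (fun s hs => (hd s hs).differentiableAt.differentiableWithinAt)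
    (fun s hs => (hd s hs).deriv) ht x.2
  rw [Function.update_eq_self, zeroExt_apply] at h1
  exact (zeroExt_apply a.1 ⟨Function.update x.1 0 t, by simpa [dom] using ht⟩).symm.trans h1

/-- The alternative for a Killing field with `X₀ ≠ 0` at some point. Since `R X⁰` does not depend on
time it is nonzero along a whole time line; there `μ` is constant and `R' (1 - μ)` vanishes. -/
theorem deriv_eq_zero_or_excess_eq_zero {I : Set ℝ} (hI : IsOpen I) (hc : IsPreconnected I)
    {R : ℝ → ℝ} (hR : ContDiffOn ℝ ∞ R I) (hpos : ∀ t ∈ I, 0 < R t) {V : Coord → Coord}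
    (hV : ContDiffOn ℝ ∞ V (dom I))
    (h : (chartFrame hI hR hpos).Killing (components hV)) {x : Coord} (hx : x ∈ dom I)
    (h0 : lower R V 0 x ≠ 0) : (∀ t ∈ I, deriv R t = 0) ∨ (∀ t ∈ I, excess R t = 0) := by
  have hp : evalAt ⟨x, hx⟩ ((chartFrame hI hR hpos).pot (components hV)) ≠ 0 := fun e =>
    h0 (by rw [lower_zero_eq hI hR hpos hV ⟨x, hx⟩, e, mul_zero])
  have hpt (t : ℝ) (ht : t ∈ I) := (evalAt_eq_of_d_zero hI hc hR hpos h.d_zero_pot ⟨x, hx⟩ ht) ▸ hp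
  have hmem (t : ℝ) (ht : t ∈ I) : Function.update x 0 t ∈ dom I := by simpa [dom] using ht
  -- the value of `∂₀μ` depends on the time only, so it suffices to look at the line through `x`
  have hdmu : (chartFrame hI hR hpos).d 0 (chartFrame hI hR hpos).mu = 0 :=
    smoothAlg_ext fun y => by
      have e := congrArg (evalAt ⟨_, hmem (y.1 0) y.2⟩) h.d_zero_mu_mul_pot
      rw [map_mul, map_zero] at e
      have e := (mul_eq_zero.1 e).resolve_right (hpt (y.1 0) y.2)
      simp only [evalAt_d_mu, Function.update_self] at e
      rw [evalAt_d_mu, e, map_zero]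
  have hprod (t : ℝ) (ht : t ∈ I) : deriv R t = 0 ∨ excess R t = 0 := by
    have e := congrArg (evalAt ⟨_, hmem t ht⟩) h.rho_mul_one_sub_mu_mul_pot
    rw [map_mul, map_zero] at e
    have e := (mul_eq_zero.1 e).resolve_right (hpt t ht)
    simpa [evalAt_mu, evalAt_rho, (hpos t ht).ne'] using e
  have hconst (t : ℝ) (ht : t ∈ I) :
      excess R t / R t ^ 2 = excess R (x 0) / R (x 0) ^ 2 := by
    simpa [evalAt_mu] using evalAt_eq_of_d_zero hI hc hR hpos hdmu ⟨x, hx⟩ ht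
  by_cases hx0 : excess R (x 0) = 0
  · exact .inr fun t ht => by simpa [hx0, (hpos t ht).ne'] using hconst t ht
  · refine .inl fun t ht => (hprod t ht).resolve_right fun e => hx0 ?_
    have e' := hconst t ht
    rw [e, zero_div, eq_comm, div_eq_zero_iff] at e'
    exact e'.resolve_right (pow_ne_zero 2 (hpos (x 0) hx).ne')

/-! ### Rotations -/

/-- The linear combination of the six rotations in North Pole coordinates. -/
noncomputable def rotationComb (c : Fin 6 → ℝ) (x : Coord) : Coord := ∑ k, c k • rotationNorth k x

theorem contDiff_rotationComb (c : Fin 6 → ℝ) : ContDiff ℝ ∞ (rotationComb c) :=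
  ContDiff.sum fun k _ => (contDiff_rotationNorth k).const_smul (c k)

/-- In the South Pole chart the meridional coefficients change sign. -/
theorem sum_smul_rotationSouth (c : Fin 6 → ℝ) (x : Coord) :
    ∑ k, c k • rotationSouth k x
      = rotationComb (fun k => if k.val < 3 then -c k else c k) x := by
  refine Finset.sum_congr rfl fun k _ => ?_
  simp only [rotationSouth]
  split_ifs <;> simp

theorem rotationComb_zero (c : Fin 6 → ℝ) (x : Coord) : rotationComb c x 0 = 0 := by
  simp [rotationComb, rotationNorth, Fin.sum_univ_succ]

theorem rotationComb_one (c : Fin 6 → ℝ) (x : Coord) : rotationComb c x 1 =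
    c 0 * (1 + x 1 ^ 2 - x 2 ^ 2 - x 3 ^ 2) / 2 + c 1 * (x 1 * x 2) + c 2 * (x 1 * x 3)
      + c 3 * x 2 - c 5 * x 3 := by
  simp [rotationComb, rotationNorth, Fin.sum_univ_six, spaceSq]; ring

theorem rotationComb_two (c : Fin 6 → ℝ) (x : Coord) : rotationComb c x 2 =
    c 0 * (x 1 * x 2) + c 1 * (1 + x 2 ^ 2 - x 1 ^ 2 - x 3 ^ 2) / 2 + c 2 * (x 2 * x 3)
      - c 3 * x 1 + c 4 * x 3 := by
  simp [rotationComb, rotationNorth, Fin.sum_univ_six, spaceSq]; ring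

theorem rotationComb_three (c : Fin 6 → ℝ) (x : Coord) : rotationComb c x 3 =
    c 0 * (x 1 * x 3) + c 1 * (x 2 * x 3) + c 2 * (1 + x 3 ^ 2 - x 1 ^ 2 - x 2 ^ 2) / 2
      - c 4 * x 2 + c 5 * x 1 := by
  simp [rotationComb, rotationNorth, Fin.sum_univ_six, spaceSq]; ring

namespace Frame

variable {A : Type*} [CommRing A] [Algebra ℝ A] {F : Frame A} {v w : Fin 4 → A}

theorem Killing.sub (hv : F.Killing v) (hw : F.Killing w) :
    F.Killing fun i => v i - w i where
  diag i := by
    simp only [map_sub, sub_mul, Finset.sum_sub_distrib]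
    linear_combination hv.diag i - hw.diag i
  off i j hij := by
    simp only [map_sub]
    linear_combination hv.off i j hij - hw.off i j hij

/-- A static field without time component is a Killing field if it is one of the round sphere. -/
theorem Killing.of_static (h0 : v 0 = 0) (ht : ∀ k : Fin 3, F.d 0 (v k.succ) = 0)
    (hoff : ∀ k l : Fin 3, k ≠ l → F.d k.succ (v l.succ) + F.d l.succ (v k.succ) = 0)
    (hdiag : ∀ k : Fin 3, F.S * F.d k.succ (v k.succ) = 2 * ∑ j, F.x j * v j.succ) :
    F.Killing v where
  diag i := by
    cases i using Fin.cases with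
    | zero => simp [Fin.sum_univ_succ (n := 3), h0, g, d_succ_r]
    | succ k =>
      have e : ∑ j : Fin 3, v j.succ * F.d j.succ (F.g k.succ)
          = 16 * F.r ^ 2 * F.q ^ 3 * ∑ j, F.x j * v j.succ := by
        rw [Finset.mul_sum]
        refine Finset.sum_congr rfl fun j _ => ?_
        simp only [g, Fin.succ_ne_zero, if_false, map_neg, d_mul, d_sq, d_succ_r, d_q, d_S,
          d_ofNat]
        ring
      rw [Fin.sum_univ_succ, h0, e, g, if_neg (Fin.succ_ne_zero k)]
      linear_combination (-8 * F.r ^ 2 * F.q ^ 3) * hdiag k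
        + 8 * F.r ^ 2 * F.q ^ 2 * F.d k.succ (v k.succ) * F.q_mul_S
  off i j hij := by
    cases i using Fin.cases with
    | zero =>
      cases j using Fin.cases with
      | zero => exact absurd rfl hij
      | succ l => rw [h0, ht, map_zero]; ring
    | succ k =>
      cases j using Fin.cases with
      | zero => rw [h0, ht, map_zero]; ring
      | succ l =>
        have e := hoff k l (by simpa using hij)
        simp only [g, Fin.succ_ne_zero, if_false]
        linear_combination -(4 * F.r ^ 2 * F.q ^ 2) * e

variable (F)

/-- The combination of the six rotations, with the coefficients of the meridional rotations
doubled, as components over the ring `A`. -/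
noncomputable def rot (b : Fin 6 → ℝ) : Fin 4 → A :=
  let a k := algebraMap ℝ A (b k)
  ![0,
    a 0 * (1 + F.x 0 ^ 2 - F.x 1 ^ 2 - F.x 2 ^ 2) + 2 * (a 1 * (F.x 0 * F.x 1))
      + 2 * (a 2 * (F.x 0 * F.x 2)) + a 3 * F.x 1 - a 5 * F.x 2,
    2 * (a 0 * (F.x 0 * F.x 1)) + a 1 * (1 + F.x 1 ^ 2 - F.x 0 ^ 2 - F.x 2 ^ 2)
      + 2 * (a 2 * (F.x 1 * F.x 2)) - a 3 * F.x 0 + a 4 * F.x 2,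
    2 * (a 0 * (F.x 0 * F.x 2)) + 2 * (a 1 * (F.x 1 * F.x 2))
      + a 2 * (1 + F.x 2 ^ 2 - F.x 0 ^ 2 - F.x 1 ^ 2) - a 4 * F.x 1 + a 5 * F.x 0]

theorem d_one_x (l : Fin 3) : F.d 1 (F.x l) = if 0 = l then 1 else 0 := F.d_succ_x 0 l

theorem d_two_x (l : Fin 3) : F.d 2 (F.x l) = if 1 = l then 1 else 0 := F.d_succ_x 1 l

theorem d_three_x (l : Fin 3) : F.d 3 (F.x l) = if 2 = l then 1 else 0 := F.d_succ_x 2 l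

theorem killing_rot (b : Fin 6 → ℝ) : F.Killing (F.rot b) := by
  refine .of_static rfl (fun k => ?_) (fun k l hkl => ?_) (fun k => ?_)
  · fin_cases k <;>
      simp [rot, d_mul, d_sq, d_zero_x, d_ofNat, -Derivation.leibniz, -Derivation.leibniz_pow]
  · fin_cases k <;> fin_cases l <;>
      simp [rot, d_mul, d_sq, d_one_x, d_two_x, d_three_x, d_ofNat, -Derivation.leibniz,
        -Derivation.leibniz_pow] at hkl ⊢ <;> ring
  · fin_cases k <;>
      simp [rot, S, d_mul, d_sq, d_one_x, d_two_x, d_three_x, d_ofNat, Fin.sum_univ_three,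
        -Derivation.leibniz, -Derivation.leibniz_pow] <;> ring

theorem map_rot_of_x_eq_zero {φ : A →+* ℝ} (hφ : ∀ c, φ (algebraMap ℝ A c) = c)
    (hx : ∀ k, φ (F.x k) = 0) (b : Fin 6 → ℝ) :
    φ (F.rot b 1) = b 0 ∧ φ (F.rot b 2) = b 1 ∧ φ (F.rot b 3) = b 2 := by
  simp [rot, hφ, hx]

theorem map_curl_rot_of_x_eq_zero {φ : A →+* ℝ} (hφ : ∀ c, φ (algebraMap ℝ A c) = c)
    (hx : ∀ k, φ (F.x k) = 0) (b : Fin 6 → ℝ) :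
    φ (F.d 2 (F.rot b 1)) = b 3 ∧ φ (F.d 3 (F.rot b 1)) = -b 5 ∧ φ (F.d 3 (F.rot b 2)) = b 4 := by
  simp [rot, hφ, hx, d_mul, d_sq, d_two_x, d_three_x, d_ofNat, -Derivation.leibniz,
    -Derivation.leibniz_pow]

end Frame

theorem components_rotationComb {I : Set ℝ} (hI : IsOpen I) {R : ℝ → ℝ}
    (hR : ContDiffOn ℝ ∞ R I) (hpos : ∀ t ∈ I, 0 < R t) (c : Fin 6 → ℝ) :
    components (I := I) (contDiff_rotationComb c).contDiffOn
      = (chartFrame hI hR hpos).rot fun k => if k.val < 3 then c k / 2 else c k := by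
  have hx (x : dom I) (k : Fin 3) : evalAt x ((chartFrame hI hR hpos).x k) = x.1 k.succ := rfl
  funext i
  refine smoothAlg_ext fun x => ?_
  rw [evalAt_components]
  fin_cases i
  · simp [Frame.rot, rotationComb_zero]
  · simp [Frame.rot, rotationComb_one, hx, map_ofNat]; ring
  · simp [Frame.rot, rotationComb_two, hx, map_ofNat]; ring
  · simp [Frame.rot, rotationComb_three, hx, map_ofNat]; ring

theorem lieMetric_rotationComb {I : Set ℝ} (hI : IsOpen I) {R : ℝ → ℝ}
    (hR : ContDiffOn ℝ ∞ R I) (hpos : ∀ t ∈ I, 0 < R t) (c : Fin 6 → ℝ) {x : Coord}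
    (hx : x ∈ dom I) (i j : Fin 4) : lieMetric R (rotationComb c) x i j = 0 :=
  (killing_components_iff hI hR hpos (contDiff_rotationComb c).contDiffOn).1
    (components_rotationComb hI hR hpos c ▸ Frame.killing_rot _ _) x hx i j

/-! ### Rigidity -/

/-- A Killing field of the round sphere is determined by its value and its curl at one point. -/
theorem components_eq_zero {I : Set ℝ} (hI : IsOpen I) (hc : IsPreconnected I)
    {R : ℝ → ℝ} (hR : ContDiffOn ℝ ∞ R I) (hpos : ∀ t ∈ I, 0 < R t)
    {v : Fin 4 → smoothAlg (dom I)} (h : (chartFrame hI hR hpos).Killing v) (h0 : v 0 = 0)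
    (p : dom I) (hp : ∀ k : Fin 3, p.1 k.succ = 0) (hv : ∀ k : Fin 3, evalAt p (v k.succ) = 0)
    (hcurl : ∀ k l : Fin 3, k < l →
      evalAt p ((chartFrame hI hR hpos).d l.succ (v k.succ)) = 0) (i : Fin 4) : v i = 0 := by
  have hconst {a : smoothAlg (dom I)} (ha : ∀ i, (chartFrame hI hR hpos).d i a = 0)
      (hap : evalAt p a = 0) : a = 0 := smoothAlg_ext fun x => by
    rw [evalAt_eq_of_partialDer_eq_zero (isOpen_dom hI) (isPreconnected_dom hc) ha x p, hap,
      map_zero]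
  have hxp (k : Fin 3) : evalAt p ((chartFrame hI hR hpos).x k) = 0 := hp k
  have hS : evalAt p (chartFrame hI hR hpos).S = 1 := by simp [Frame.S, hxp]
  have hpot : (chartFrame hI hR hpos).pot v = 0 := by rw [Frame.pot, h0, mul_zero]
  have hconf0 : evalAt p ((chartFrame hI hR hpos).conf v) = 0 := by
    simpa [hS, hpot, hxp] using congrArg (evalAt p) h.S_mul_conf
  have hdconf (k : Fin 3) :
      (chartFrame hI hR hpos).d k.succ ((chartFrame hI hR hpos).conf v) = 0 := by
    refine hconst (fun i => h.d_d_conf_of_zero h0 i k) ?_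
    simpa [hS, hpot, hxp, hv, map_ofNat] using congrArg (evalAt p) (h.d_S_mul_conf k)
  have hconf : (chartFrame hI hR hpos).conf v = 0 := by
    refine hconst (fun i => ?_) hconf0
    cases i using Fin.cases with
    | zero => rw [Frame.conf, Frame.comm, h.d_zero_eq_zero h0, map_zero]
    | succ k => exact hdconf k
  have hd (j k : Fin 3) : (chartFrame hI hR hpos).d j.succ (v k.succ) = 0 := by
    refine hconst (fun i => h.d_d_eq_zero h0 hconf i j k) ?_
    rcases lt_trichotomy k j with hkj | rfl | hkj
    · exact hcurl k j hkj
    · rw [h.d_diag, hconf, map_zero]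
    · rw [eq_neg_of_add_eq_zero_left (h.d_off hkj.ne), map_neg, hcurl j k hkj, neg_zero]
  cases i using Fin.cases with
  | zero => exact h0
  | succ k =>
    refine hconst (fun i => ?_) (hv k)
    cases i using Fin.cases with
    | zero => exact h.d_zero_eq_zero h0 k
    | succ j => exact hd j k

/-- At the origin of the chart a meridional rotation has half a unit vector as value and no curl, an
equatorial one vanishes and has unit curl; this determines the coefficients. -/
theorem exists_eq_rotationComb {I : Set ℝ} (hI : IsOpen I) (hc : IsConnected I)
    {R : ℝ → ℝ} (hR : ContDiffOn ℝ ∞ R I) (hpos : ∀ t ∈ I, 0 < R t) {V : Coord → Coord}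
    (hV : ContDiffOn ℝ ∞ V (dom I)) (h : (chartFrame hI hR hpos).Killing (components hV))
    (h0 : ∀ x ∈ dom I, V x 0 = 0) : ∃ c, ∀ x ∈ dom I, V x = rotationComb c x := by
  obtain ⟨t, ht⟩ := hc.nonempty
  let p : dom I := ⟨Pi.single 0 t, by simpa [dom] using ht⟩
  have hp (k : Fin 3) : p.1 k.succ = 0 := by simp [p]
  have hxp (k : Fin 3) : evalAt p ((chartFrame hI hR hpos).x k) = 0 := hp k
  let D (i j : Fin 4) : ℝ := evalAt p ((chartFrame hI hR hpos).d i (components hV j))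
  let c : Fin 6 → ℝ := ![2 * V p 1, 2 * V p 2, 2 * V p 3, D 2 1, D 3 2, D 1 3]
  have hrot := components_rotationComb hI hR hpos c
  have hD : D 1 3 + D 3 1 = 0 := by
    simpa using congrArg (evalAt p) (h.d_off (k := 0) (l := 2) (by decide))
  have hφ (c : ℝ) : evalAt p (algebraMap ℝ (smoothAlg (dom I)) c) = c := rfl
  let b (k : Fin 6) : ℝ := if k.val < 3 then c k / 2 else c k
  obtain ⟨v1, v2, v3⟩ := Frame.map_rot_of_x_eq_zero _ hφ hxp b
  obtain ⟨d21, d31, d32⟩ := Frame.map_curl_rot_of_x_eq_zero _ hφ hxp b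
  have hW := components_eq_zero hI hc.isPreconnected hR hpos
    (h.sub ((chartFrame hI hR hpos).killing_rot b))
    (smoothAlg_ext fun x => by simp [Frame.rot, evalAt_components, h0 x x.2]) p hp
    (fun k => by
      rw [map_sub, evalAt_components]
      fin_cases k
      · exact sub_eq_zero.2 (.trans (show V p 1 = b 0 by simp [b, c]) v1.symm)
      · exact sub_eq_zero.2 (.trans (show V p 2 = b 1 by simp [b, c]) v2.symm)
      · exact sub_eq_zero.2 (.trans (show V p 3 = b 2 by simp [b, c]) v3.symm))
    (fun k l hkl => by
      rw [map_sub, map_sub]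
      fin_cases k <;> fin_cases l <;> simp at hkl
      · exact sub_eq_zero.2 d21.symm
      · exact sub_eq_zero.2 ((eq_neg_of_add_eq_zero_right hD).trans d31.symm)
      · exact sub_eq_zero.2 d32.symm)
  refine ⟨c, fun x hx => funext fun i => ?_⟩
  have e := congrArg (evalAt ⟨x, hx⟩) (sub_eq_zero.1 (hW i))
  rwa [← hrot] at e

/-! ### Passing between the charts -/

theorem spaceSq_transition (x : Coord) : spaceSq (transition x) = (spaceSq x)⁻¹ := by
  have : spaceSq (transition x) = spaceSq x / spaceSq x ^ 2 := by
    simp only [spaceSq, transition, Matrix.cons_val, div_pow, add_div]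
  rw [this]
  by_cases h : spaceSq x = 0
  · simp [h]
  · field_simp

theorem transition_transition {x : Coord} (h : spaceSq x ≠ 0) :
    transition (transition x) = x := by
  have e := spaceSq_transition x
  funext i
  fin_cases i
  · rfl
  · change x 1 / spaceSq x / spaceSq (transition x) = x 1
    rw [e]; field_simp
  · change x 2 / spaceSq x / spaceSq (transition x) = x 2
    rw [e]; field_simp
  · change x 3 / spaceSq x / spaceSq (transition x) = x 3
    rw [e]; field_simp

/-- Continuous fields that agree away from the pole agree at the pole. -/
theorem eqOn_dom_of_spaceSq_ne_zero {I : Set ℝ} (hI : IsOpen I) {f g : Coord → Coord}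
    (hf : ContinuousOn f (dom I)) (hg : ContinuousOn g (dom I))
    (h : ∀ x ∈ dom I, spaceSq x ≠ 0 → f x = g x) : Set.EqOn f g (dom I) := by
  intro x hx
  by_cases h0 : spaceSq x = 0
  -- the pole is approached along the first space axis
  · have hx1 : x 1 = 0 := by
      unfold spaceSq at h0
      nlinarith [sq_nonneg (x 1), sq_nonneg (x 2), sq_nonneg (x 3)]
    have ht : Filter.Tendsto (fun s : ℝ => Function.update x 1 s) (nhdsWithin 0 {0}ᶜ) (nhds x) := by
      have : Continuous fun s : ℝ => Function.update x 1 s :=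
        continuous_const.update 1 continuous_id
      have h1 := this.tendsto 0
      rw [← hx1, Function.update_eq_self, hx1] at h1
      exact h1.mono_left nhdsWithin_le_nhds
    have hn := (isOpen_dom hI).mem_nhds hx
    refine tendsto_nhds_unique_of_eventuallyEq ((hf.continuousAt hn).tendsto.comp ht)
      ((hg.continuousAt hn).tendsto.comp ht) ?_
    filter_upwards [self_mem_nhdsWithin] with s hs
    refine h _ (by simpa [dom] using hx) ?_
    have hs0 : s ≠ 0 := hs
    have : 0 < s ^ 2 := by positivity
    simp only [spaceSq, Function.update_self]
    positivity
  · exact h x hx h0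

/-- A field that is a combination of rotations in the North Pole chart is one on `I × S³`. -/
theorem isRotationCombination_of_north {I : Set ℝ} (hI : IsOpen I) (X : VField I) {c : Fin 6 → ℝ}
    (h : ∀ x ∈ dom I, X.north x = rotationComb c x) : IsRotationCombination X c := by
  have hs : Set.EqOn X.south (fun y => ∑ k, c k • rotationSouth k y) (dom I) := by
    refine eqOn_dom_of_spaceSq_ne_zero hI X.smooth_south.continuousOn ?_ fun y hy h0 => ?_
    · exact (ContDiff.sum fun k _ =>
        (contDiff_rotationSouth k).const_smul (c k)).continuous.continuousOn
    · have hx : transition y ∈ dom I := hy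
      have hx0 : spaceSq (transition y) ≠ 0 := by rw [spaceSq_transition]; exact inv_ne_zero h0
      have e := X.compatible _ hx hx0
      rw [h _ hx, rotationComb, map_sum] at e
      rw [← transition_transition h0, e]
      refine Finset.sum_congr rfl fun k _ => ?_
      rw [map_smul]
      exact congrArg _ ((rotation I k).compatible _ hx hx0).symm
  exact fun x hx => ⟨h x hx, hs hx⟩

theorem rotationComb_injective {I : Set ℝ} (hI : I.Nonempty) {c c' : Fin 6 → ℝ}
    (h : ∀ x ∈ dom I, rotationComb c x = rotationComb c' x) : c = c' := by
  obtain ⟨t, ht⟩ := hI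
  have h0 := h ![t, 0, 0, 0] ht
  have h1 := h ![t, 1, 0, 0] ht
  have h2 := h ![t, 0, 1, 0] ht
  have a1 := congrFun h0 1
  have a2 := congrFun h0 2
  have a3 := congrFun h0 3
  have b2 := congrFun h1 2
  have b3 := congrFun h1 3
  have c3 := congrFun h2 3
  simp only [rotationComb_one, rotationComb_two, rotationComb_three, Matrix.cons_val] at *
  funext k
  fin_cases k <;> simp only [Fin.mk_one, Fin.zero_eta, Fin.reduceFinMk] <;> linarith

/-! ### Killing fields on `I × S³` -/

section

variable {I : Set ℝ} (hI : IsOpen I) {R : ℝ → ℝ} (hR : ContDiffOn ℝ ∞ R I)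
  (hpos : ∀ t ∈ I, 0 < R t)

theorem IsKilling.north {X : VField I} (h : IsKilling R X) :
    (chartFrame hI hR hpos).Killing (components X.smooth_north) :=
  (killing_components_iff hI hR hpos _).2 fun x hx i j => (h x hx i j).1

theorem IsKilling.south {X : VField I} (h : IsKilling R X) :
    (chartFrame hI hR hpos).Killing (components X.smooth_south) :=
  (killing_components_iff hI hR hpos _).2 fun x hx i j => (h x hx i j).2

end

theorem lieMetric_congr {I : Set ℝ} (hI : IsOpen I) {R : ℝ → ℝ} {V W : Coord → Coord}
    (h : Set.EqOn V W (dom I)) {x : Coord} (hx : x ∈ dom I) (i j : Fin 4) :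
    lieMetric R V x i j = lieMetric R W x i j := by
  have hpd (a b : Fin 4) : pd a (fun y => V y b) x = pd a (fun y => W y b) x :=
    pd_congr (isOpen_dom hI) (fun y hy => congrFun (h hy) b) a hx
  simp only [lieMetric, hpd, h hx]

theorem IsRotationCombination.isKilling {I : Set ℝ} (hI : IsOpen I) {R : ℝ → ℝ}
    (hR : ContDiffOn ℝ ∞ R I) (hpos : ∀ t ∈ I, 0 < R t) {X : VField I} {c : Fin 6 → ℝ}
    (h : IsRotationCombination X c) : IsKilling R X := by
  intro x hx i j
  constructor
  · rw [lieMetric_congr hI (W := rotationComb c) (fun y hy => (h y hy).1) hx]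
    exact lieMetric_rotationComb hI hR hpos _ hx i j
  · rw [lieMetric_congr hI (fun y hy => (h y hy).2.trans (sum_smul_rotationSouth c y)) hx]
    exact lieMetric_rotationComb hI hR hpos _ hx i j

theorem isKilling_rotation {I : Set ℝ} (hI : IsOpen I) {R : ℝ → ℝ}
    (hR : ContDiffOn ℝ ∞ R I) (hpos : ∀ t ∈ I, 0 < R t) (k : Fin 6) :
    IsKilling R (rotation I k) := by
  refine IsRotationCombination.isKilling hI hR hpos (c := Pi.single k 1) fun x _ => ?_
  simp [Pi.single_apply]

theorem normSq_eq {R : ℝ → ℝ} {V : Coord → Coord} {x : Coord} (h0 : V x 0 = 0) :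
    normSq R V x
      = -(4 * R (x 0) ^ 2 / (spaceSq x + 1) ^ 2 * (V x 1 ^ 2 + V x 2 ^ 2 + V x 3 ^ 2)) := by
  simp [normSq, metric, Matrix.diagonal_apply, Fin.sum_univ_four, h0]
  ring

theorem spacelikeAt_of_zero {R : ℝ → ℝ} {V : Coord → Coord} {x : Coord} (hR : 0 < R (x 0))
    (h0 : V x 0 = 0) : ¬ TimelikeAt R V x ∧ (V x ≠ 0 → SpacelikeAt R V x) := by
  have hs := spaceSq_add_one_pos x
  rw [TimelikeAt, SpacelikeAt, normSq_eq h0]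
  refine ⟨by rw [not_lt, neg_nonpos]; positivity, fun h => ?_⟩
  have hV : 0 < V x 1 ^ 2 + V x 2 ^ 2 + V x 3 ^ 2 := by
    refine lt_of_le_of_ne (by positivity) fun e => h ?_
    funext i
    fin_cases i
    · exact h0
    all_goals
      refine pow_eq_zero_iff (two_ne_zero) |>.1 ?_
      simp only [Fin.mk_one, Fin.reduceFinMk]
      nlinarith [sq_nonneg (V x 1), sq_nonneg (V x 2), sq_nonneg (V x 3)]
  rw [neg_lt_zero]
  positivity

theorem lower_zero_eq_zero_iff {R : ℝ → ℝ} {V : Coord → Coord} {x : Coord} (hR : 0 < R (x 0)) :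
    lower R V 0 x = 0 ↔ V x 0 = 0 := by
  rw [lower_eq, mul_eq_zero, or_iff_right (metric_ne_zero hR.ne' 0)]

end ClosedUniverse

theorem mainTheorem4 (I : Set ℝ) (hIo : IsOpen I) (hIc : IsConnected I)
    (R : ℝ → ℝ) (hR : ContDiffOn ℝ ∞ R I) (hpos : ∀ t ∈ I, 0 < R t) :
    -- every Killing field satisfies the compatibility conditions, everywhere in both charts
    (∀ X : ClosedUniverse.VField I, ClosedUniverse.IsKilling R X → ∀ x ∈ ClosedUniverse.dom I,
      ClosedUniverse.CompatibilityAt R X.north x ∧ ClosedUniverse.CompatibilityAt R X.south x) ∧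
    -- a Killing field with X_0 not identically zero exists only in the two exceptional cases
    (∀ X : ClosedUniverse.VField I, ClosedUniverse.IsKilling R X →
      (∃ x ∈ ClosedUniverse.dom I,
        ClosedUniverse.lower R X.north 0 x ≠ 0 ∨ ClosedUniverse.lower R X.south 0 x ≠ 0) →
      (∀ t ∈ I, deriv R t = 0) ∨ (∀ t ∈ I, ClosedUniverse.excess R t = 0)) ∧
    -- the six rotations are always Killing fields
    (∀ k : Fin 6, ClosedUniverse.IsKilling R (ClosedUniverse.rotation I k)) ∧
    -- outside the exceptional cases
    (¬ (∀ t ∈ I, deriv R t = 0) → ¬ (∀ t ∈ I, ClosedUniverse.excess R t = 0) →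
      -- no Killing field is time-like at any point; each is space-like wherever it is nonzero
      (∀ X : ClosedUniverse.VField I, ClosedUniverse.IsKilling R X → ∀ x ∈ ClosedUniverse.dom I,
        (ClosedUniverse.lower R X.north 0 x = 0 ∧ ¬ ClosedUniverse.TimelikeAt R X.north x ∧
          (X.north x ≠ 0 → ClosedUniverse.SpacelikeAt R X.north x)) ∧
        (ClosedUniverse.lower R X.south 0 x = 0 ∧ ¬ ClosedUniverse.TimelikeAt R X.south x ∧
          (X.south x ≠ 0 → ClosedUniverse.SpacelikeAt R X.south x))) ∧
      -- the Killing fields are the combinations of the six rotations, with unique coefficients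
      (∀ X : ClosedUniverse.VField I, ClosedUniverse.IsKilling R X ↔
        ∃! c : Fin 6 → ℝ, ClosedUniverse.IsRotationCombination X c)) := by
  have main (V : ClosedUniverse.Coord → ClosedUniverse.Coord)
      (hV : ContDiffOn ℝ ∞ V (ClosedUniverse.dom I))
      (h : (ClosedUniverse.chartFrame hIo hR hpos).Killing (ClosedUniverse.components hV))
      (h1 : ¬ (∀ t ∈ I, deriv R t = 0)) (h2 : ¬ (∀ t ∈ I, ClosedUniverse.excess R t = 0))
      (x : ClosedUniverse.Coord) (hx : x ∈ ClosedUniverse.dom I) :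
      ClosedUniverse.lower R V 0 x = 0 := by
    by_contra h0
    rcases ClosedUniverse.deriv_eq_zero_or_excess_eq_zero hIo hIc.isPreconnected hR hpos hV h hx h0
      with e | e
    exacts [h1 e, h2 e]
  refine ⟨fun X h x hx =>
      ⟨ClosedUniverse.compatibilityAt hIo hR hpos _ (h.north hIo hR hpos) ⟨x, hx⟩,
        ClosedUniverse.compatibilityAt hIo hR hpos _ (h.south hIo hR hpos) ⟨x, hx⟩⟩,
    ?_, ClosedUniverse.isKilling_rotation hIo hR hpos, fun h1 h2 => ⟨fun X h x hx => ?_,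
      fun X => ⟨fun h => ?_, fun ⟨c, hc, _⟩ => hc.isKilling hIo hR hpos⟩⟩⟩
  · rintro X h ⟨x, hx, h0 | h0⟩
    · exact ClosedUniverse.deriv_eq_zero_or_excess_eq_zero hIo hIc.isPreconnected hR hpos _
        (h.north hIo hR hpos) hx h0
    · exact ClosedUniverse.deriv_eq_zero_or_excess_eq_zero hIo hIc.isPreconnected hR hpos _
        (h.south hIo hR hpos) hx h0
  · have hn := main _ _ (h.north hIo hR hpos) h1 h2 x hx
    have hs := main _ _ (h.south hIo hR hpos) h1 h2 x hx
    exact ⟨⟨hn, ClosedUniverse.spacelikeAt_of_zero (hpos _ hx)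
        ((ClosedUniverse.lower_zero_eq_zero_iff (hpos _ hx)).1 hn)⟩,
      ⟨hs, ClosedUniverse.spacelikeAt_of_zero (hpos _ hx)
        ((ClosedUniverse.lower_zero_eq_zero_iff (hpos _ hx)).1 hs)⟩⟩
  · obtain ⟨c, hc⟩ := ClosedUniverse.exists_eq_rotationComb hIo hIc hR hpos _
      (h.north hIo hR hpos) fun x hx => (ClosedUniverse.lower_zero_eq_zero_iff (hpos _ hx)).1
        (main _ _ (h.north hIo hR hpos) h1 h2 x hx)
    exact ⟨c, ClosedUniverse.isRotationCombination_of_north hIo X hc, fun c' hc' =>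
      ClosedUniverse.rotationComb_injective hIc.nonempty fun x hx =>
        (hc' x hx).1.symm.trans (hc x hx)⟩
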